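/- Let $X$ be a finite set of points in $\mathbb{R}^2$. Let $V(X)$ be the set of extreme points of the convex hull of $X$, and put $X_1=X$, $X_{i+1}=X_i\setminus V(X_i)$ for $i\ge 1$. The layer number of $X$ is $L(X)=\min\{k\ge 0: X_{k+1}=\emptyset\}$. For $\alpha>1$, the set $X$ is called $\alpha$-evenly distributed in a unit disk if $X$ is contained in some closed disk of radius $1$ and $$|X\cap D|\le\big\lceil \alpha\,|X|\,\mathrm{Vol}(D)\big\rceil$$ for every closed Euclidean disk $D$ of positive radius, where $\mathrm{Vol}(D)$ is the area of $D$. **Theorem.** Fix $\alpha>1$. (i) There is a constant $K>0$, depending only on $\alpha$, such that $L(X)\le K\,|X|^{3/4}$ for every finite set $X\subset\mathbb{R}^2$ that is $\alpha$-evenly distributed in a unit disk. (ii) The exponent $3/4$ is sharp, as shown by points spaced along the boundaries of nested regular polygons: there are constants $C,\beta,a,b,c>0$, depending only on $\alpha$, such that for every sufficiently large integer $n$ there is a finite set $X\subset\mathbb{R}^2$ that is $\alpha$-evenly distributed in a unit disk and satisfies $$a\,n\le|X|\le b\,n\qquad\text{and}\qquad L(X)\ge c\,|X|^{3/4},$$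 where every point of $X$ lies on the boundary of one of the polygons $P_1,P_2,\dots,P_{\lfloor\sqrt n/C\rfloor}$, any two distinct points of $X$ have distance at least $\beta n^{-1/2}$, and $P_j$ denotes the regular $\lfloor n^{1/4}\rfloor$-gon centred at the origin with circumradius $jC/\sqrt n$ and a vertex on the positive $x$-axis (so $P_j$ is $P_1$ scaled by the factor $j$). -/

import Mathlib

open Filter Metric MeasureTheory

/-- The convex layer `V(X)`: the extreme points of (the convex hull of) a finite point set `X`.
They automatically belong to `X`. -/
noncomputable def convexLayer {d : ℕ} (X : Finset (EuclideanSpace ℝ (Fin d))) :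
    Finset (EuclideanSpace ℝ (Fin d)) :=
  open Classical in
  X.filter (fun x => x ∈ (convexHull ℝ (X : Set (EuclideanSpace ℝ (Fin d)))).extremePoints ℝ)

/-- The peeling sequence of `X`, indexed from `0`: start with `X` and remove the convex layer of
the current set at each step. -/
noncomputable def peelingSeq {d : ℕ} (X : Finset (EuclideanSpace ℝ (Fin d))) :
    ℕ → Finset (EuclideanSpace ℝ (Fin d))
  | 0 => X
  | k + 1 => open Classical in peelingSeq X k \ convexLayer (peelingSeq X k)

/-- The layer number `L(X)`: the least number of peeling steps after which no point is left. -/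
noncomputable def layerNumber {d : ℕ} (X : Finset (EuclideanSpace ℝ (Fin d))) : ℕ :=
  sInf {k : ℕ | peelingSeq X k = ∅}

theorem convexLayer_nonempty {d : ℕ} {X : Finset (EuclideanSpace ℝ (Fin d))} (hX : X.Nonempty) :
    (convexLayer X).Nonempty := by
  classical
  have hc : IsCompact (convexHull ℝ (X : Set (EuclideanSpace ℝ (Fin d)))) :=
    X.finite_toSet.isCompact_convexHull ℝ
  have hne : (convexHull ℝ (X : Set (EuclideanSpace ℝ (Fin d)))).Nonempty :=
    (Finset.coe_nonempty.mpr hX).convexHull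
  obtain ⟨x, hx⟩ := hc.extremePoints_nonempty hne
  exact ⟨x, Finset.mem_filter.mpr ⟨Finset.mem_coe.mp (extremePoints_convexHull_subset hx), hx⟩⟩

/-- The peeling process ends, so the infimum defining `layerNumber` is attained. -/
theorem peelingSeq_layerNumber {d : ℕ} (X : Finset (EuclideanSpace ℝ (Fin d))) :
    peelingSeq X (layerNumber X) = ∅ := by
  classical
  have h : ∀ k, (peelingSeq X k).card ≤ X.card - k := by
    intro k
    induction k with
    | zero => simp [peelingSeq]
    | succ k ih =>
      rcases (peelingSeq X k).eq_empty_or_nonempty with h0 | h0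
      · simp [peelingSeq, h0]
      · have h1 : (peelingSeq X (k + 1)).card < (peelingSeq X k).card := by
          obtain ⟨x, hx⟩ := convexLayer_nonempty h0
          refine Finset.card_lt_card ⟨?_, fun hs => ?_⟩
          · intro y hy
            exact (Finset.mem_sdiff.mp hy).1
          · exact (Finset.mem_sdiff.mp (hs (Finset.mem_filter.mp hx).1)).2 hx
        omega
  have hne : {k : ℕ | peelingSeq X k = ∅}.Nonempty :=
    ⟨X.card, Finset.card_eq_zero.mp (by have := h X.card; omega)⟩
  exact Nat.sInf_mem hne

/-- `X` is an `α`-evenly distributed point set in a unit ball (with arbitrary centre): every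
Euclidean ball `D` of positive radius contains at most `⌈α |X| Vol(D)⌉` points of `X`. -/
def IsEvenlyDistributed {d : ℕ} (α : ℝ) (X : Finset (EuclideanSpace ℝ (Fin d))) : Prop :=
  (∃ p : EuclideanSpace ℝ (Fin d), (X : Set (EuclideanSpace ℝ (Fin d))) ⊆ closedBall p 1) ∧
  ∀ (c : EuclideanSpace ℝ (Fin d)) (r : ℝ), 0 < r →
    ((X : Set (EuclideanSpace ℝ (Fin d))) ∩ closedBall c r).ncard ≤
      ⌈α * (X.card : ℝ) * volume.real (closedBall c r)⌉₊

/-- The (filled) regular `k`-gon centred at the origin with circumradius `R`. -/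
noncomputable def regularPolygon (k : ℕ) (R : ℝ) : Set (EuclideanSpace ℝ (Fin 2)) :=
  convexHull ℝ (Set.range fun i : Fin k =>
    (!₂[R * Real.cos (2 * Real.pi * (i : ℝ) / (k : ℝ)),
        R * Real.sin (2 * Real.pi * (i : ℝ) / (k : ℝ))] : EuclideanSpace ℝ (Fin 2)))

/-! Upper bound. Put n = |X| and δ = n^(-1/2), so that even distribution allows only O(1) points in
a disk of radius δ. If the current set lies in a disk of radius R ≤ 1, a cap of depth δ of that disk
has width O(√δ), hence is covered by O(δ^(-1/2)) = O(n^(1/4)) disks of radius δ and holds O(n^(1/4))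
points. A linear functional is maximized on a hull at an extreme point, so every peeling step
removes a point from every nonempty cap. After O(n^(1/4)) steps all these caps are empty and the
radius has dropped by δ; O(n^(1/2)) such rounds exhaust X. The carriers are `card_cap_le`,
`card_filter_peelingSeq_le` and `peelingSeq_subset_shrink`.

Sharpness. With w = n^(1/4), take ⌊w⌋-gons with circumradii jρ, where ρ = 20/w², and equally spaced
points on their edges. While the midpoints of the edges of the j-th polygon stay in the hull, the
hull contains the disk of radius jρ cos²(π/k), k = ⌊w⌋. This disk contains the (j-1)-st polygon in
its interior as soon as j sin²(π/k) < 1, which holds throughout because j ≤ w²/20. So inner points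
are protected, and a step takes at most one point from each end of each outer edge, the others lying
between two neighbours on the edge. The j-th polygon thus costs about j/w steps, and summing over j
≤ w²/20 gives order w³ (`ContainsCore.peel`, `ContainsCore.sum_le_layerNumber`).

Even distribution for every α > 1 leaves little room for constants. It follows from a minimum
distance s with π|X|s² > 10 (`isEvenlyDistributed_of_separated`). A square arrangement in each
sector would give only about π² < 10; shifting alternate rows by half a step allows 23π²/20 ≈ 11.35.
-/

/-! ### Rotated orthonormal coordinates in the plane. -/

abbrev Plane := EuclideanSpace ℝ (Fin 2)

/-- The coordinate of a point in the direction of angle `θ`. -/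
noncomputable def dirCoord (θ : ℝ) : Plane →ₗ[ℝ] ℝ where
  toFun x := x 0 * Real.cos θ + x 1 * Real.sin θ
  map_add' x y := by simp; ring
  map_smul' c x := by simp; ring

theorem dirCoord_apply (θ : ℝ) (x : Plane) :
    dirCoord θ x = x 0 * Real.cos θ + x 1 * Real.sin θ := rfl

theorem norm_sq_plane (x : Plane) : ‖x‖ ^ 2 = x 0 ^ 2 + x 1 ^ 2 := by
  simp [EuclideanSpace.norm_sq_eq, Fin.sum_univ_two]

theorem norm_sq_eq_dirCoord (θ : ℝ) (x : Plane) :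
    ‖x‖ ^ 2 = dirCoord θ x ^ 2 + dirCoord (θ + Real.pi / 2) x ^ 2 := by
  rw [norm_sq_plane, dirCoord_apply, dirCoord_apply, Real.cos_add_pi_div_two,
    Real.sin_add_pi_div_two]
  linear_combination (-(x 0 ^ 2 + x 1 ^ 2)) * Real.sin_sq_add_cos_sq θ

theorem dirCoord_add_angle (θ φ : ℝ) (x : Plane) :
    dirCoord (θ + φ) x =
      Real.cos φ * dirCoord θ x + Real.sin φ * dirCoord (θ + Real.pi / 2) x := by
  simp only [dirCoord_apply, Real.cos_add_pi_div_two, Real.sin_add_pi_div_two]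
  rw [Real.cos_add, Real.sin_add]
  ring

theorem abs_dirCoord_le (θ : ℝ) (x : Plane) : |dirCoord θ x| ≤ ‖x‖ := by
  refine abs_le_of_sq_le_sq ?_ (norm_nonneg x)
  rw [norm_sq_eq_dirCoord θ x]
  nlinarith [sq_nonneg (dirCoord (θ + Real.pi / 2) x)]

theorem exists_polar_angle (x : Plane) :
    ∃ θ : ℝ, x 0 = ‖x‖ * Real.cos θ ∧ x 1 = ‖x‖ * Real.sin θ := by
  have h : ‖(⟨x 0, x 1⟩ : ℂ)‖ = ‖x‖ := by
    rw [← sq_eq_sq₀ (norm_nonneg _) (norm_nonneg _), norm_sq_plane, Complex.sq_norm,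
      Complex.normSq_mk]
    ring
  refine ⟨Complex.arg ⟨x 0, x 1⟩, ?_, ?_⟩
  · rw [← h, Complex.norm_mul_cos_arg]
  · rw [← h, Complex.norm_mul_sin_arg]

theorem exists_dirCoord_eq_norm (x : Plane) : ∃ θ : ℝ, dirCoord θ x = ‖x‖ := by
  obtain ⟨θ, h0, h1⟩ := exists_polar_angle x
  refine ⟨θ, ?_⟩
  rw [dirCoord_apply, h0, h1]
  linear_combination ‖x‖ * Real.sin_sq_add_cos_sq θ

/-- The point with coordinates `a`, `b` in the orthonormal frame rotated by `θ`. -/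
noncomputable def framePoint (θ a b : ℝ) : Plane :=
  !₂[a * Real.cos θ - b * Real.sin θ, a * Real.sin θ + b * Real.cos θ]

theorem dirCoord_framePoint (θ a b : ℝ) : dirCoord θ (framePoint θ a b) = a := by
  simp only [dirCoord_apply, framePoint, Matrix.cons_val_zero, Matrix.cons_val_one]
  linear_combination a * Real.sin_sq_add_cos_sq θ

theorem dirCoord_framePoint_perp (θ a b : ℝ) :
    dirCoord (θ + Real.pi / 2) (framePoint θ a b) = b := by
  simp only [dirCoord_apply, framePoint, Matrix.cons_val_zero,
    Matrix.cons_val_one, Real.cos_add_pi_div_two, Real.sin_add_pi_div_two]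
  linear_combination b * Real.sin_sq_add_cos_sq θ

theorem eq_of_dirCoord_eq (θ : ℝ) {x y : Plane} (h : dirCoord θ x = dirCoord θ y)
    (h' : dirCoord (θ + Real.pi / 2) x = dirCoord (θ + Real.pi / 2) y) : x = y := by
  have := norm_sq_eq_dirCoord θ (x - y)
  rw [map_sub, map_sub, h, h'] at this
  rw [← sub_eq_zero, ← norm_eq_zero]
  simpa using this

theorem dist_sq_eq_dirCoord (θ : ℝ) (x y : Plane) :
    dist x y ^ 2 = (dirCoord θ x - dirCoord θ y) ^ 2 +
      (dirCoord (θ + Real.pi / 2) x - dirCoord (θ + Real.pi / 2) y) ^ 2 := by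
  rw [dist_eq_norm, norm_sq_eq_dirCoord θ, map_sub, map_sub]

/-! ### Peeling -/

theorem coe_convexLayer {d : ℕ} (X : Finset (EuclideanSpace ℝ (Fin d))) :
    (convexLayer X : Set (EuclideanSpace ℝ (Fin d))) =
      (convexHull ℝ (X : Set (EuclideanSpace ℝ (Fin d)))).extremePoints ℝ := by
  ext x
  simp only [convexLayer, Finset.coe_filter, Set.mem_ofPred_eq, and_iff_right_iff_imp]
  exact fun h => Finset.mem_coe.mp (extremePoints_convexHull_subset h)

theorem convexHull_convexLayer {d : ℕ} (X : Finset (EuclideanSpace ℝ (Fin d))) :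
    convexHull ℝ (convexLayer X : Set (EuclideanSpace ℝ (Fin d))) =
      convexHull ℝ (X : Set (EuclideanSpace ℝ (Fin d))) := by
  rw [← closure_convexHull_extremePoints (X.finite_toSet.isCompact_convexHull ℝ)
    (convex_convexHull ℝ _), ← coe_convexLayer]
  exact ((convexLayer X).finite_toSet.isClosed_convexHull ℝ).closure_eq.symm

/-- The layer spans the same hull as `X`, so a closed half-space containing the layer contains all
of `X`. -/
theorem exists_mem_convexLayer_lt {d : ℕ} {X : Finset (EuclideanSpace ℝ (Fin d))}
    (f : EuclideanSpace ℝ (Fin d) →ₗ[ℝ] ℝ) {c : ℝ} {x : EuclideanSpace ℝ (Fin d)} (hx : x ∈ X)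
    (hc : c < f x) : ∃ y ∈ convexLayer X, c < f y := by
  by_contra! h
  have h1 : convexHull ℝ (convexLayer X : Set (EuclideanSpace ℝ (Fin d))) ⊆ {y | f y ≤ c} :=
    convexHull_min h (convex_halfSpace_le f.isLinear c)
  rw [convexHull_convexLayer] at h1
  exact hc.not_ge (h1 (subset_convexHull ℝ _ hx))

theorem peelingSeq_succ {d : ℕ} (X : Finset (EuclideanSpace ℝ (Fin d))) (k : ℕ)
    (x : EuclideanSpace ℝ (Fin d)) :
    x ∈ peelingSeq X (k + 1) ↔ x ∈ peelingSeq X k ∧ x ∉ convexLayer (peelingSeq X k) := by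
  classical
  rw [peelingSeq, Finset.mem_sdiff]

theorem peelingSeq_antitone {d : ℕ} (X : Finset (EuclideanSpace ℝ (Fin d))) :
    Antitone (peelingSeq X) :=
  antitone_nat_of_succ_le fun k _ hx => ((peelingSeq_succ X k _).mp hx).1

theorem card_filter_peelingSeq_le {d : ℕ} (X : Finset (EuclideanSpace ℝ (Fin d)))
    (f : EuclideanSpace ℝ (Fin d) →ₗ[ℝ] ℝ) (c : ℝ) (k m : ℕ) :
    ((peelingSeq X (k + m)).filter (fun x => c < f x)).card ≤
      ((peelingSeq X k).filter (fun x => c < f x)).card - m := by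
  induction m with
  | zero => simp
  | succ m ih =>
    rcases ((peelingSeq X (k + (m + 1))).filter (fun x => c < f x)).eq_empty_or_nonempty
      with h0 | ⟨x, hx⟩
    · simp [h0]
    · rw [Finset.mem_filter] at hx
      obtain ⟨y, hy, hcy⟩ :=
        exists_mem_convexLayer_lt f (peelingSeq_antitone X (Nat.le_succ (k + m)) hx.1) hx.2
      have hlt : ((peelingSeq X (k + (m + 1))).filter (fun x => c < f x)).card <
          ((peelingSeq X (k + m)).filter (fun x => c < f x)).card := by
        refine Finset.card_lt_card ⟨Finset.filter_subset_filter _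
          (peelingSeq_antitone X (Nat.le_succ (k + m))), fun hs => ?_⟩
        have hyX : y ∈ peelingSeq X (k + m) := by
          classical
          exact (Finset.mem_filter.mp hy).1
        have := hs (Finset.mem_filter.mpr ⟨hyX, hcy⟩)
        exact ((peelingSeq_succ X (k + m) y).mp (Finset.mem_filter.mp this).1).2 hy
      omega

theorem layerNumber_le {d : ℕ} {X : Finset (EuclideanSpace ℝ (Fin d))} {k : ℕ}
    (h : peelingSeq X k = ∅) : layerNumber X ≤ k := Nat.sInf_le h

/-! ### The upper bound -/

/-- By Pythagoras the cap has half-width at most √(2δ) ≤ δN. Cutting it transversally into pieces of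
length δ gives 2N + 1 squares of side δ, each inside a disk of radius δ about its centre. -/
theorem card_cap_le {Z : Finset Plane} {p : Plane} {R δ : ℝ} {B N : ℕ} (θ : ℝ) (hR1 : R ≤ 1)
    (hδ : 0 < δ) (hZ : ∀ x ∈ Z, dist x p ≤ R)
    (hB : ∀ c : Plane, ((Z : Set Plane) ∩ closedBall c δ).ncard ≤ B)
    (hN : 2 ≤ δ * (N : ℝ) ^ 2) :
    (Z.filter (fun x => dirCoord θ p + (R - δ) < dirCoord θ x)).card ≤ B * (2 * N + 1) := by
  classical
  set W := Z.filter (fun x => dirCoord θ p + (R - δ) < dirCoord θ x) with hW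
  set t : Plane → ℝ := fun x => dirCoord (θ + Real.pi / 2) (x - p) with ht
  have hmaps : ∀ x ∈ W, ⌊t x / δ⌋ ∈ Finset.Icc (-(N : ℤ)) N := by
    intro x hx
    rw [hW, Finset.mem_filter] at hx
    have h1 : R - δ < dirCoord θ (x - p) := by rw [map_sub]; linarith [hx.2]
    have h2 := norm_sq_eq_dirCoord θ (x - p)
    have h3 := hZ x hx.1
    rw [dist_eq_norm] at h3
    have hR0 : 0 ≤ R := (norm_nonneg _).trans h3
    have h4 : dirCoord θ (x - p) ≤ R := (le_abs_self _).trans ((abs_dirCoord_le _ _).trans h3)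
    have h5 : t x ^ 2 ≤ 2 * δ := by
      have h6 : ‖x - p‖ ^ 2 ≤ R ^ 2 := by gcongr
      rcases le_total δ R with h | h
      · nlinarith
      · nlinarith [sq_nonneg (dirCoord θ (x - p))]
    have h6 : |t x| ≤ δ * N := by
      refine abs_le_of_sq_le_sq ?_ (by positivity)
      nlinarith
    rw [abs_le] at h6
    rw [Finset.mem_Icc]
    constructor
    · rw [Int.le_floor, le_div_iff₀ hδ]; push_cast; linarith
    · have : (⌊t x / δ⌋ : ℝ) ≤ N := (Int.floor_le _).trans (by rw [div_le_iff₀ hδ]; linarith)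
      exact_mod_cast this
  have hcard := Finset.card_le_mul_card_image_of_maps_to hmaps B (fun z _ => ?_)
  · simpa [Int.card_Icc, show ((N : ℤ) + 1 + N).toNat = 2 * N + 1 by omega] using hcard
  · rw [← Set.ncard_coe_finset]
    refine (Set.ncard_le_ncard ?_ (Z.finite_toSet.inter_of_left _)).trans
      (hB (p + framePoint θ (R - δ / 2) ((z + 1 / 2) * δ)))
    intro x hx
    simp only [Finset.coe_filter, Set.mem_ofPred_eq] at hx
    obtain ⟨hxW, hz⟩ := hx
    rw [hW, Finset.mem_filter] at hxW
    refine ⟨hxW.1, ?_⟩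
    have h1 : R - δ < dirCoord θ (x - p) := by rw [map_sub]; linarith [hxW.2]
    have h3 := hZ x hxW.1
    rw [dist_eq_norm] at h3
    have h4 : dirCoord θ (x - p) ≤ R := (le_abs_self _).trans ((abs_dirCoord_le _ _).trans h3)
    rw [Int.floor_eq_iff, le_div_iff₀ hδ, div_lt_iff₀ hδ] at hz
    rw [mem_closedBall, ← sq_le_sq₀ dist_nonneg hδ.le, dist_eq_norm, ← sub_sub,
      norm_sq_eq_dirCoord θ, map_sub, map_sub _ (x - p), dirCoord_framePoint,
      dirCoord_framePoint_perp]
    have h5 : (dirCoord θ (x - p) - (R - δ / 2)) ^ 2 ≤ (δ / 2) ^ 2 :=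
      sq_le_sq' (by linarith) (by linarith)
    have h6 : (dirCoord (θ + Real.pi / 2) (x - p) - (z + 1 / 2) * δ) ^ 2 ≤ (δ / 2) ^ 2 :=
      sq_le_sq' (by simp only [ht] at hz; linarith) (by simp only [ht] at hz; linarith)
    nlinarith

theorem peelingSeq_subset_shrink {X : Finset Plane} {p : Plane} {R δ : ℝ} {B N k : ℕ}
    (hR1 : R ≤ 1) (hδ : 0 < δ) (hX : ∀ x ∈ peelingSeq X k, dist x p ≤ R)
    (hB : ∀ c : Plane, ((X : Set Plane) ∩ closedBall c δ).ncard ≤ B)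
    (hN : 2 ≤ δ * (N : ℝ) ^ 2) :
    ∀ x ∈ peelingSeq X (k + B * (2 * N + 1)), dist x p ≤ R - δ := by
  intro x hx
  -- The cap is taken in the direction of `x` itself: were `x` farther than `R - δ` from `p`, it
  -- would lie in a cap already emptied.
  obtain ⟨θ, hθ⟩ := exists_dirCoord_eq_norm (x - p)
  have hB' : ∀ c : Plane, ((peelingSeq X k : Set Plane) ∩ closedBall c δ).ncard ≤ B := fun c =>
    (Set.ncard_le_ncard (Set.inter_subset_inter_left _
      (Finset.coe_subset.mpr (peelingSeq_antitone X (Nat.zero_le k))))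
      (X.finite_toSet.inter_of_left _)).trans (hB c)
  have h1 := card_cap_le θ hR1 hδ hX hB' hN
  have h2 := card_filter_peelingSeq_le X (dirCoord θ) (dirCoord θ p + (R - δ)) k (B * (2 * N + 1))
  have h3 : (peelingSeq X (k + B * (2 * N + 1))).filter
      (fun x => dirCoord θ p + (R - δ) < dirCoord θ x) = ∅ :=
    Finset.card_eq_zero.mp (Nat.le_zero.mp (h2.trans (Nat.sub_eq_zero_of_le h1).le))
  have h4 := Finset.filter_eq_empty_iff.mp h3 hx
  rw [dist_eq_norm, ← hθ, map_sub]
  linarith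

theorem layerNumber_le_of_ncard_le {X : Finset Plane} {p : Plane} {δ : ℝ} {B N Q : ℕ}
    (hδ : 0 < δ) (hX : ∀ x ∈ X, dist x p ≤ 1)
    (hB : ∀ c : Plane, ((X : Set Plane) ∩ closedBall c δ).ncard ≤ B)
    (hN : 2 ≤ δ * (N : ℝ) ^ 2) (hQ : 1 < δ * Q) :
    layerNumber X ≤ Q * (B * (2 * N + 1)) := by
  have key : ∀ q : ℕ, ∀ x ∈ peelingSeq X (q * (B * (2 * N + 1))), dist x p ≤ 1 - q * δ := by
    intro q
    induction q with
    | zero => simpa [peelingSeq] using hX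
    | succ q ih =>
      rw [add_mul, one_mul]
      intro x hx
      have := peelingSeq_subset_shrink (by nlinarith [(Nat.cast_nonneg q : (0 : ℝ) ≤ q)]) hδ ih
        hB hN x hx
      push_cast
      linarith
  apply layerNumber_le
  rw [Finset.eq_empty_iff_forall_notMem]
  intro x hx
  have := key Q x hx
  linarith [dist_nonneg (x := x) (y := p)]

theorem volume_real_closedBall_plane (c : Plane) {r : ℝ} (hr : 0 ≤ r) :
    volume.real (closedBall c r) = Real.pi * r ^ 2 := by
  rw [measureReal_def, EuclideanSpace.volume_closedBall_fin_two]
  simp [hr, Real.pi_nonneg]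
  ring

theorem exists_layerNumber_le_rpow {α : ℝ} (hα : 0 < α) :
    ∃ K : ℝ, 0 < K ∧ ∀ X : Finset Plane, IsEvenlyDistributed α X →
      (layerNumber X : ℝ) ≤ K * (X.card : ℝ) ^ (3 / 4 : ℝ) := by
  set B : ℕ := ⌈α * Real.pi⌉₊ with hBdef
  have hBpos : 0 < B := Nat.ceil_pos.mpr (by positivity)
  refine ⟨3 * (B * 7), by positivity, fun X hX => ?_⟩
  rcases X.eq_empty_or_nonempty with h0 | hne
  · have : layerNumber X ≤ 0 := layerNumber_le (by simpa [peelingSeq] using h0)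
    rw [Nat.le_zero.mp this]
    simp only [Nat.cast_zero]
    positivity
  obtain ⟨⟨p, hp⟩, hD⟩ := hX
  have hn : (1 : ℝ) ≤ X.card := by exact_mod_cast hne.card_pos
  set w : ℝ := (X.card : ℝ) ^ (1 / 4 : ℝ) with hw
  have hw1 : 1 ≤ w := Real.one_le_rpow hn (by norm_num)
  have hw4 : w ^ 4 = X.card := by
    rw [hw, ← Real.rpow_natCast, ← Real.rpow_mul (by linarith)]; norm_num
  have hw3 : w ^ 3 = (X.card : ℝ) ^ (3 / 4 : ℝ) := by
    rw [hw, ← Real.rpow_natCast, ← Real.rpow_mul (by linarith)]; norm_num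
  have hδ : (0 : ℝ) < 1 / w ^ 2 := by positivity
  have hB : ∀ c : Plane, ((X : Set Plane) ∩ closedBall c (1 / w ^ 2)).ncard ≤ B := by
    intro c
    refine (hD c _ hδ).trans (le_of_eq ?_)
    rw [volume_real_closedBall_plane _ hδ.le, ← hw4, hBdef]
    congr 1
    field_simp
  have hN : 2 ≤ 1 / w ^ 2 * ((⌈2 * w⌉₊ : ℕ) : ℝ) ^ 2 := by
    have : (2 * w) ^ 2 ≤ ((⌈2 * w⌉₊ : ℕ) : ℝ) ^ 2 := by gcongr; exact Nat.le_ceil _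
    rw [one_div, inv_mul_eq_div, le_div_iff₀ (by positivity)]
    nlinarith
  -- The strict inequality makes the final radius negative, so that no point, not even the centre,
  -- survives.
  have hQ : 1 < 1 / w ^ 2 * ((⌊w ^ 2⌋₊ + 1 : ℕ) : ℝ) := by
    rw [one_div, inv_mul_eq_div, lt_div_iff₀ (by positivity)]
    push_cast
    linarith [Nat.lt_floor_add_one (w ^ 2)]
  have h := layerNumber_le_of_ncard_le hδ hp hB hN hQ
  have h' : (layerNumber X : ℝ) ≤ (⌊w ^ 2⌋₊ + 1) * (B * (2 * ⌈2 * w⌉₊ + 1)) := by exact_mod_cast h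
  rw [← hw3]
  refine h'.trans ?_
  have h1 : (⌊w ^ 2⌋₊ : ℝ) + 1 ≤ 2 * w ^ 2 := by
    have := Nat.floor_le (show 0 ≤ w ^ 2 by positivity)
    nlinarith
  have h2 : (⌈2 * w⌉₊ : ℝ) ≤ 2 * w + 1 := (Nat.ceil_lt_add_one (by positivity)).le
  have hB0 : (0 : ℝ) < B := by exact_mod_cast hBpos
  calc ((⌊w ^ 2⌋₊ : ℝ) + 1) * (B * (2 * ⌈2 * w⌉₊ + 1))
      ≤ (2 * w ^ 2) * (B * (2 * (2 * w + 1) + 1)) := by gcongr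
    _ ≤ (2 * w ^ 2) * (B * (7 * w)) := by gcongr; linarith
    _ ≤ 3 * (B * 7) * w ^ 3 := by nlinarith [show 0 < B * w ^ 3 by positivity]

/-! ### Separated point sets are evenly distributed -/

/-- Area comparison: the disks of radius s/2 about the points are disjoint and lie in the disk of
radius r + s/2. -/
theorem card_mul_sq_le_of_separated {F : Finset Plane} {c : Plane} {r s : ℝ} (hs : 0 < s)
    (hr : 0 ≤ r) (hsep : ∀ x ∈ F, ∀ y ∈ F, x ≠ y → s ≤ dist x y)
    (hF : ∀ x ∈ F, dist x c ≤ r) : F.card * (s / 2) ^ 2 ≤ (r + s / 2) ^ 2 := by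
  have hdisj : (F : Set Plane).PairwiseDisjoint (fun x => ball x (s / 2)) := by
    intro x hx y hy hxy
    exact ball_disjoint_ball (by linarith [hsep x hx y hy hxy])
  have hsub : (⋃ x ∈ F, ball x (s / 2)) ⊆ closedBall c (r + s / 2) := by
    refine Set.iUnion₂_subset fun x hx => ?_
    exact ball_subset_closedBall.trans (closedBall_subset_closedBall' (by linarith [hF x hx]))
  have h1 := measureReal_mono (μ := volume) hsub measure_closedBall_lt_top.ne
  rw [measureReal_biUnion_finset hdisj (fun _ _ => measurableSet_ball)
    (fun _ _ => measure_ball_lt_top.ne), volume_real_closedBall_plane _ (by positivity)] at h1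
  have h2 : ∀ x : Plane, volume.real (ball x (s / 2)) = Real.pi * (s / 2) ^ 2 := by
    intro x
    rw [← volume_real_closedBall_plane x (by positivity), measureReal_def, measureReal_def,
      Measure.addHaar_closedBall_eq_addHaar_ball]
  simp only [h2, Finset.sum_const, nsmul_eq_mul] at h1
  nlinarith [Real.pi_pos]

/-- The difference of the two sides is 2‖∑ (x - c)‖². -/
theorem sum_sum_dist_sq_le (F : Finset Plane) (c : Plane) :
    ∑ x ∈ F, ∑ y ∈ F, dist x y ^ 2 ≤ 2 * F.card * ∑ x ∈ F, dist x c ^ 2 := by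
  have h : ∀ x y : Plane, dist x y ^ 2 =
      dist x c ^ 2 + dist y c ^ 2 - 2 * inner ℝ (x - c) (y - c) := by
    intro x y
    rw [dist_eq_norm, dist_eq_norm, dist_eq_norm, ← sub_sub_sub_cancel_right x y c,
      norm_sub_sq_real]
    ring
  have h2 : ∑ x ∈ F, ∑ y ∈ F, inner ℝ (x - c) (y - c) = ‖∑ x ∈ F, (x - c)‖ ^ 2 := by
    rw [← real_inner_self_eq_norm_sq, sum_inner]
    simp_rw [inner_sum]
  rw [Finset.sum_congr rfl fun x _ => Finset.sum_congr rfl fun y _ => h x y]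
  simp_rw [Finset.sum_sub_distrib, Finset.sum_add_distrib, Finset.sum_const, nsmul_eq_mul,
    ← Finset.mul_sum]
  rw [h2]
  nlinarith [sq_nonneg ‖∑ x ∈ F, (x - c)‖]

theorem card_sub_one_mul_sq_le_of_separated {F : Finset Plane} {c : Plane} {r s : ℝ} (hs : 0 < s)
    (hne : F.Nonempty) (hsep : ∀ x ∈ F, ∀ y ∈ F, x ≠ y → s ≤ dist x y)
    (hF : ∀ x ∈ F, dist x c ≤ r) : (F.card - 1 : ℝ) * s ^ 2 ≤ 2 * F.card * r ^ 2 := by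
  classical
  have hN : (0 : ℝ) < F.card := by exact_mod_cast hne.card_pos
  have h1 := sum_sum_dist_sq_le F c
  have h2 : ∑ x ∈ F, dist x c ^ 2 ≤ F.card * r ^ 2 := by
    rw [← nsmul_eq_mul]
    exact Finset.sum_le_card_nsmul _ _ _ fun x hx => by gcongr; exact hF x hx
  have h3 : F.card * ((F.card - 1 : ℝ) * s ^ 2) ≤ ∑ x ∈ F, ∑ y ∈ F, dist x y ^ 2 := by
    rw [← nsmul_eq_mul]
    refine Finset.card_nsmul_le_sum _ _ _ fun x hx => ?_
    rw [← Finset.add_sum_erase F _ hx, dist_self]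
    have : ((F.erase x).card : ℝ) = F.card - 1 := by
      rw [Finset.card_erase_of_mem hx, Nat.cast_sub hne.card_pos, Nat.cast_one]
    have h4 : (F.erase x).card • s ^ 2 ≤ ∑ y ∈ F.erase x, dist x y ^ 2 := by
      refine Finset.card_nsmul_le_sum _ _ _ fun y hy => ?_
      have := hsep x hx y (Finset.mem_of_mem_erase hy) (Finset.ne_of_mem_erase hy).symm
      gcongr
    rw [nsmul_eq_mul, this] at h4
    linarith
  have h4 : F.card * ((F.card - 1 : ℝ) * s ^ 2) ≤ F.card * (2 * F.card * r ^ 2) := by nlinarith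
  exact le_of_mul_le_mul_left h4 hN

/-- For m ≤ 5 points the sum of squared distances gives (m - 1)s² ≤ 2mr² ≤ 10r². For m ≥ 6 the area
bound gives (√m - 1)s ≤ 2r, and m - 1 ≤ (5/2)(√m - 1)² because √m ≥ 7/3; again the constant is 10.
-/
theorem card_sub_one_lt_of_separated {F : Finset Plane} {c : Plane} {r s A : ℝ} (hs : 0 < s)
    (hr : 0 < r) (hne : F.Nonempty) (hsep : ∀ x ∈ F, ∀ y ∈ F, x ≠ y → s ≤ dist x y)
    (hF : ∀ x ∈ F, dist x c ≤ r) (hA : 10 < A) : (F.card - 1 : ℝ) * s ^ 2 < A * r ^ 2 := by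
  have hr2 : 0 < r ^ 2 := by positivity
  rcases le_or_gt F.card 5 with h | h
  · have h1 := card_sub_one_mul_sq_le_of_separated hs hne hsep hF
    have h2 : (F.card : ℝ) ≤ 5 := by exact_mod_cast h
    nlinarith
  · have h1 := card_mul_sq_le_of_separated hs hr.le hsep hF
    have h2 : (6 : ℝ) ≤ F.card := by exact_mod_cast h
    set q := √(F.card : ℝ) with hq
    have hq2 : q ^ 2 = F.card := Real.sq_sqrt (by positivity)
    have hq0 : 0 ≤ q := Real.sqrt_nonneg _
    have hq3 : (12 / 5 : ℝ) ≤ q := Real.le_sqrt_of_sq_le (by linarith)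
    rw [← hq2, ← mul_pow, sq_le_sq₀ (by positivity) (by positivity)] at h1
    have h3 : (q - 1) * s ≤ 2 * r := by linarith
    have h4 : ((q - 1) * s) ^ 2 ≤ (2 * r) ^ 2 :=
      pow_le_pow_left₀ (mul_nonneg (by linarith) hs.le) h3 2
    have h5 : (q ^ 2 - 1) * s ^ 2 ≤ 5 / 2 * ((q - 1) * s) ^ 2 := by
      have : 0 ≤ (q - 1) * (3 * q - 7) * s ^ 2 :=
        mul_nonneg (mul_nonneg (by linarith) (by linarith)) (sq_nonneg s)
      nlinarith
    rw [← hq2]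
    nlinarith

theorem isEvenlyDistributed_of_separated {X : Finset Plane} {α s : ℝ} (hs : 0 < s)
    (hX : ∃ p : Plane, (X : Set Plane) ⊆ closedBall p 1)
    (hsep : ∀ x ∈ X, ∀ y ∈ X, x ≠ y → s ≤ dist x y)
    (hA : 10 < α * X.card * Real.pi * s ^ 2) : IsEvenlyDistributed α X := by
  classical
  refine ⟨hX, fun c r hr => ?_⟩
  have hcoe : (X : Set Plane) ∩ closedBall c r =
      ((X.filter (fun x => dist x c ≤ r) : Finset Plane) : Set Plane) := by
    ext x; simp
  rw [hcoe, Set.ncard_coe_finset]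
  set F := X.filter (fun x => dist x c ≤ r)
  rcases F.eq_empty_or_nonempty with h0 | hne
  · simp [h0]
  have h := card_sub_one_lt_of_separated hs hr hne
    (fun x hx y hy => hsep x (Finset.mem_filter.mp hx).1 y (Finset.mem_filter.mp hy).1)
    (fun x hx => (Finset.mem_filter.mp hx).2) hA
  -- The ceiling gains one point: a bound on |F| - 1 suffices, which is essential for small disks.
  have h1 : F.card - 1 < ⌈α * (X.card : ℝ) * volume.real (closedBall c r)⌉₊ := by
    rw [Nat.lt_ceil, volume_real_closedBall_plane _ hr.le, Nat.cast_sub hne.card_pos, Nat.cast_one]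
    have hs2 : 0 < s ^ 2 := by positivity
    refine lt_of_mul_lt_mul_right ?_ hs2.le
    linarith
  omega

/-! ### Sectors -/

theorem cos_pi_div_pos {k : ℕ} (hk : 3 ≤ k) : 0 < Real.cos (Real.pi / k) := by
  have hk' : (3 : ℝ) ≤ k := by exact_mod_cast hk
  refine Real.cos_pos_of_mem_Ioo ⟨?_, ?_⟩
  · have : 0 ≤ Real.pi / k := by positivity
    linarith [Real.pi_pos]
  · exact div_lt_div_of_pos_left Real.pi_pos (by norm_num) (by linarith)

theorem sin_pi_div_pos {k : ℕ} (hk : 3 ≤ k) : 0 < Real.sin (Real.pi / k) := by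
  have hk' : (3 : ℝ) ≤ k := by exact_mod_cast hk
  refine Real.sin_pos_of_pos_of_lt_pi (by positivity) ?_
  rw [div_lt_iff₀ (by linarith)]
  nlinarith [Real.pi_pos]

/-- A point of an open sector has a strictly larger coordinate along its own bisector than along any
other. With a = π/k, the claim reduces to B cos(ma) < A sin(ma), which holds since |cot(ma)| ≤ cot
a. -/
theorem mul_cos_add_mul_sin_lt {k m : ℕ} {A B : ℝ} (hm : 1 ≤ m) (hmk : m < k)
    (hAB : |B| * Real.cos (Real.pi / k) < A * Real.sin (Real.pi / k)) :
    A * Real.cos (2 * (m * (Real.pi / k))) + B * Real.sin (2 * (m * (Real.pi / k))) < A := by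
  set a := Real.pi / k with ha
  have hk : (0 : ℝ) < k := by exact_mod_cast (by omega : 0 < k)
  have hka : k * a = Real.pi := by rw [ha]; field_simp
  have hm1 : (1 : ℝ) ≤ m := by exact_mod_cast hm
  have hmk' : (m : ℝ) + 1 ≤ k := by exact_mod_cast hmk
  have ha0 : 0 < a := by positivity
  have hsm : 0 < Real.sin (m * a) := Real.sin_pos_of_pos_of_lt_pi (by positivity) (by nlinarith)
  have hp : 0 ≤ Real.sin (m * a + a) :=
    Real.sin_nonneg_of_nonneg_of_le_pi (by positivity) (by nlinarith)
  have hn : 0 ≤ Real.sin (m * a - a) :=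
    Real.sin_nonneg_of_nonneg_of_le_pi (by nlinarith) (by nlinarith)
  have hs1 : 0 < Real.sin a := Real.sin_pos_of_pos_of_lt_pi ha0 (by nlinarith)
  rw [Real.sin_add] at hp
  rw [Real.sin_sub] at hn
  have hc : |Real.cos (m * a)| * Real.sin a ≤ Real.sin (m * a) * Real.cos a := by
    rcases abs_cases (Real.cos (m * a)) with ⟨h, _⟩ | ⟨h, _⟩ <;> rw [h] <;> linarith
  have key : B * Real.cos (m * a) < A * Real.sin (m * a) := by
    have h1 : |B| * |Real.cos (m * a)| * Real.sin a ≤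
        |B| * (Real.sin (m * a) * Real.cos a) := by
      rw [mul_assoc]; exact mul_le_mul_of_nonneg_left hc (abs_nonneg B)
    have h2 : |B| * Real.cos a * Real.sin (m * a) < A * Real.sin a * Real.sin (m * a) :=
      mul_lt_mul_of_pos_right hAB hsm
    have h3 : B * Real.cos (m * a) ≤ |B| * |Real.cos (m * a)| := by
      rw [← abs_mul]; exact le_abs_self _
    have h4 : B * Real.cos (m * a) * Real.sin a < A * Real.sin (m * a) * Real.sin a := by
      nlinarith
    exact lt_of_mul_lt_mul_right h4 hs1.le
  rw [Real.cos_two_mul, Real.sin_two_mul]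
  have h5 := mul_lt_mul_of_pos_right key hsm
  rw [Real.cos_sq']
  linarith

/-- The hypothesis `hx` says that `x` is at signed distance at least s/2 from both sides of the
sector; the angles θ ± (π/2 - a) used below are those of the inner unit normals. -/
theorem sector_of_dist_lt {θ a s : ℝ} {x z : Plane}
    (hx : s / 2 + |dirCoord (θ + Real.pi / 2) x| * Real.cos a ≤ dirCoord θ x * Real.sin a)
    (ha : 0 ≤ Real.cos a) (hz : dist z x < s / 2) :
    |dirCoord (θ + Real.pi / 2) z| * Real.cos a < dirCoord θ z * Real.sin a := by
  rw [dist_eq_norm] at hz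
  have h1 := (abs_le.mp (abs_dirCoord_le (θ + (a - Real.pi / 2)) (z - x))).1
  have h2 := (abs_le.mp (abs_dirCoord_le (θ + (Real.pi / 2 - a)) (z - x))).1
  rw [dirCoord_add_angle, Real.cos_sub_pi_div_two, Real.sin_sub_pi_div_two, map_sub, map_sub] at h1
  rw [dirCoord_add_angle, Real.cos_pi_div_two_sub, Real.sin_pi_div_two_sub, map_sub, map_sub] at h2
  have h3 := mul_le_mul_of_nonneg_right (le_abs_self (dirCoord (θ + Real.pi / 2) x)) ha
  have h4 := mul_le_mul_of_nonneg_right (neg_abs_le (dirCoord (θ + Real.pi / 2) x)) ha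
  rcases abs_cases (dirCoord (θ + Real.pi / 2) z) with ⟨h, _⟩ | ⟨h, _⟩ <;> rw [h] <;> nlinarith

/-- If the points were closer than s, their midpoint would lie in two different open sectors, which
are disjoint. -/
theorem le_dist_of_sectors {k l l' : ℕ} {s : ℝ} {x y : Plane} (hk : 2 ≤ k) (hl : l < l')
    (hl' : l' < k)
    (hx : s / 2 + |dirCoord ((2 * l + 1) * (Real.pi / k) + Real.pi / 2) x| *
      Real.cos (Real.pi / k) ≤ dirCoord ((2 * l + 1) * (Real.pi / k)) x * Real.sin (Real.pi / k))
    (hy : s / 2 + |dirCoord ((2 * l' + 1) * (Real.pi / k) + Real.pi / 2) y| *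
      Real.cos (Real.pi / k) ≤ dirCoord ((2 * l' + 1) * (Real.pi / k)) y * Real.sin (Real.pi / k)) :
    s ≤ dist x y := by
  by_contra! hlt
  have hk' : (2 : ℝ) ≤ k := by exact_mod_cast hk
  have hcos : 0 ≤ Real.cos (Real.pi / k) := by
    have h0 : 0 ≤ Real.pi / k := by positivity
    refine Real.cos_nonneg_of_neg_pi_div_two_le_of_le (by linarith [Real.pi_pos]) ?_
    exact div_le_div_of_nonneg_left Real.pi_pos.le (by norm_num) hk'
  have hzx : dist (midpoint ℝ x y) x < s / 2 := by
    rw [dist_midpoint_left]; norm_num; linarith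
  have hzy : dist (midpoint ℝ x y) y < s / 2 := by
    rw [dist_midpoint_right]; norm_num; linarith
  have h1 := sector_of_dist_lt hx hcos hzx
  have h2 := sector_of_dist_lt hy hcos hzy
  obtain ⟨m, rfl⟩ : ∃ m, l' = l + m := ⟨l' - l, by omega⟩
  generalize midpoint ℝ x y = z at h1 h2
  have hm : 1 ≤ m := by omega
  have hmk : m < k := by omega
  rw [← abs_neg] at h2
  have h3 := mul_cos_add_mul_sin_lt hm hmk h1
  have h4 := mul_cos_add_mul_sin_lt hm hmk h2
  have e1 : (2 * ((l + m : ℕ) : ℝ) + 1) * (Real.pi / k) =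
      (2 * l + 1) * (Real.pi / k) + 2 * (m * (Real.pi / k)) := by push_cast; ring
  have e2 : (2 * (l : ℝ) + 1) * (Real.pi / k) =
      (2 * ((l + m : ℕ) : ℝ) + 1) * (Real.pi / k) + -(2 * (m * (Real.pi / k))) := by
    push_cast; ring
  have h5 : dirCoord ((2 * ((l + m : ℕ) : ℝ) + 1) * (Real.pi / k)) z <
      dirCoord ((2 * (l : ℝ) + 1) * (Real.pi / k)) z := by
    rw [e1, dirCoord_add_angle]; linarith
  have h6 : dirCoord ((2 * (l : ℝ) + 1) * (Real.pi / k)) z <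
      dirCoord ((2 * ((l + m : ℕ) : ℝ) + 1) * (Real.pi / k)) z := by
    rw [e2, dirCoord_add_angle, Real.cos_neg, Real.sin_neg]; linarith
  exact lt_asymm h5 h6

/-! ### The nested polygon configuration -/

/-- The number of half-steps from the midpoint of an edge of the `j`-th polygon to its last
configuration point. -/
noncomputable def halfWidth (k j : ℕ) : ℤ :=
  ⌊(40 / 23 * j * Real.sin (Real.pi / k) - 1) / Real.cos (Real.pi / k)⌋

/-- The `i`-th point on the `l`-th edge of the regular `k`-gon of circumradius `j * ρ`. -/
noncomputable def edgePoint (k : ℕ) (ρ : ℝ) (l j : ℕ) (i : ℤ) : Plane :=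
  framePoint ((2 * l + 1) * (Real.pi / k)) (j * (ρ * Real.cos (Real.pi / k)))
    (i * (23 / 40 * (ρ * Real.cos (Real.pi / k))))

/-- The indices `((l, j), i)` of the configuration points. -/
noncomputable def nestedIndex (k J : ℕ) : Finset (Σ _ : ℕ × ℕ, ℤ) :=
  (Finset.range k ×ˢ Finset.Icc 1 J).sigma fun p =>
    (Finset.Icc (-halfWidth k p.2) (halfWidth k p.2)).filter fun i => Even (i + p.2)

/-- Points spaced along the boundaries of `J` nested regular `k`-gons. -/
noncomputable def nestedPoints (k : ℕ) (ρ : ℝ) (J : ℕ) : Finset Plane :=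
  open Classical in (nestedIndex k J).image fun q => edgePoint k ρ q.1.1 q.1.2 q.2

theorem mem_nestedPoints {k J : ℕ} {ρ : ℝ} {x : Plane} :
    x ∈ nestedPoints k ρ J ↔ ∃ l < k, ∃ j, 1 ≤ j ∧ j ≤ J ∧ ∃ i : ℤ, |i| ≤ halfWidth k j ∧
      Even (i + j) ∧ edgePoint k ρ l j i = x := by
  classical
  simp only [nestedPoints, nestedIndex, Finset.mem_image, Finset.mem_sigma, Finset.mem_product,
    Finset.mem_range, Finset.mem_Icc, Finset.mem_filter, ← abs_le]
  constructor
  · rintro ⟨⟨⟨l, j⟩, i⟩, ⟨⟨hl, h1, h2⟩, h3, h4⟩, rfl⟩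
    exact ⟨l, hl, j, h1, h2, i, h3, h4, rfl⟩
  · rintro ⟨l, hl, j, h1, h2, i, h3, h4, rfl⟩
    exact ⟨⟨⟨l, j⟩, i⟩, ⟨⟨hl, h1, h2⟩, h3, h4⟩, rfl⟩

theorem abs_mul_cos_le_of_abs_le_halfWidth {k j : ℕ} {i : ℤ}
    (hc : 0 < Real.cos (Real.pi / k)) (hi : |i| ≤ halfWidth k j) :
    |(i : ℝ)| * Real.cos (Real.pi / k) ≤ 40 / 23 * j * Real.sin (Real.pi / k) - 1 := by
  rw [← le_div_iff₀ hc]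
  rw [halfWidth, Int.le_floor] at hi
  exact_mod_cast hi

/-- The cutoff `halfWidth` is chosen to be exactly this margin of half the minimum distance, which
separates points on different edge directions. -/
theorem edgePoint_mem_sector {k j : ℕ} {i : ℤ} {ρ : ℝ} (l : ℕ) (hρ : 0 < ρ)
    (hc : 0 < Real.cos (Real.pi / k)) (hi : |i| ≤ halfWidth k j) :
    23 / 20 * (ρ * Real.cos (Real.pi / k)) / 2 +
      |dirCoord ((2 * l + 1) * (Real.pi / k) + Real.pi / 2) (edgePoint k ρ l j i)| *
        Real.cos (Real.pi / k) ≤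
      dirCoord ((2 * l + 1) * (Real.pi / k)) (edgePoint k ρ l j i) * Real.sin (Real.pi / k) := by
  have h := abs_mul_cos_le_of_abs_le_halfWidth hc hi
  rw [edgePoint, dirCoord_framePoint, dirCoord_framePoint_perp, abs_mul,
    abs_of_pos (show 0 < 23 / 40 * (ρ * Real.cos (Real.pi / k)) by positivity)]
  have h1 := mul_le_mul_of_nonneg_left h
    (show 0 ≤ 23 / 40 * (ρ * Real.cos (Real.pi / k)) by positivity)
  linarith

theorem edgePoint_separated {k : ℕ} {ρ : ℝ} (hρ : 0 < ρ) (hk : 3 ≤ k)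
    {l j l' j' : ℕ} {i i' : ℤ} (hl : l < k) (hl' : l' < k) (hi : |i| ≤ halfWidth k j)
    (hi' : |i'| ≤ halfWidth k j') (hp : Even (i + j)) (hp' : Even (i' + j'))
    (hne : ¬ (l = l' ∧ j = j' ∧ i = i')) :
    23 / 20 * (ρ * Real.cos (Real.pi / k)) ≤
      dist (edgePoint k ρ l j i) (edgePoint k ρ l' j' i') := by
  have hc := cos_pi_div_pos hk
  rcases lt_trichotomy l l' with h | rfl | h
  · exact le_dist_of_sectors (by omega) h hl' (edgePoint_mem_sector l hρ hc hi)
      (edgePoint_mem_sector l' hρ hc hi')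
  · set g := ρ * Real.cos (Real.pi / k) with hg
    have hg0 : 0 < g := by positivity
    rw [← sq_le_sq₀ (by positivity) dist_nonneg,
      dist_sq_eq_dirCoord ((2 * l + 1) * (Real.pi / k)), edgePoint, edgePoint,
      dirCoord_framePoint, dirCoord_framePoint, dirCoord_framePoint_perp, dirCoord_framePoint_perp]
    -- In units of g/40 rows are 40 apart and half-steps are 23. By parity, distinct points in one
    -- row differ by at least two half-steps, and those in adjacent rows by at least one: 1600 + 529
    -- ≥ 4 · 529. Two rows apart, 4 · 1600 suffices.
    have h1 : (529 : ℤ) * 4 ≤ 1600 * (j - j' : ℤ) ^ 2 + 529 * (i - i') ^ 2 := by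
      have hev : Even ((i - i') + (j - j' : ℤ)) := by
        rw [show (i - i') + (j - j' : ℤ) = (i + j) - (i' + j') by ring]
        exact hp.sub hp'
      have hne' : ¬ ((j - j' : ℤ) = 0 ∧ i - i' = 0) := by
        rintro ⟨h1, h2⟩; exact hne ⟨rfl, by omega, by omega⟩
      generalize (j - j' : ℤ) = u at hev hne' ⊢
      generalize i - i' = v at hev hne' ⊢
      rcases Int.lt_trichotomy u 0 with hu | rfl | hu
      · rcases eq_or_lt_of_le (show u ≤ -1 by omega) with rfl | hu'
        · have hv : v ≠ 0 := by rintro rfl; revert hev; decide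
          have : 1 ≤ v ^ 2 := Int.add_one_le_iff.mpr (by positivity : 0 < v ^ 2)
          nlinarith
        · nlinarith [sq_nonneg v]
      · have : v ≤ -2 ∨ 2 ≤ v := by
          obtain ⟨r, hr⟩ := hev; omega
        rcases this with h | h <;> nlinarith
      · rcases eq_or_lt_of_le (show 1 ≤ u by omega) with rfl | hu'
        · have hv : v ≠ 0 := by rintro rfl; revert hev; decide
          have : 1 ≤ v ^ 2 := Int.add_one_le_iff.mpr (by positivity : 0 < v ^ 2)
          nlinarith
        · nlinarith [sq_nonneg v]
    have h2 : (529 : ℝ) * 4 ≤ 1600 * (j - j' : ℝ) ^ 2 + 529 * ((i : ℝ) - i') ^ 2 := by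
      exact_mod_cast h1
    have h3 := mul_le_mul_of_nonneg_right h2 (sq_nonneg g)
    nlinarith
  · rw [dist_comm]
    exact le_dist_of_sectors (by omega) h hl (edgePoint_mem_sector l' hρ hc hi')
      (edgePoint_mem_sector l hρ hc hi)

theorem norm_framePoint_sq (θ a b : ℝ) : ‖framePoint θ a b‖ ^ 2 = a ^ 2 + b ^ 2 := by
  rw [norm_sq_eq_dirCoord θ, dirCoord_framePoint, dirCoord_framePoint_perp]

theorem dirCoord_framePoint_zero (θ φ a : ℝ) :
    dirCoord θ (framePoint φ a 0) = a * Real.cos (θ - φ) := by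
  simp only [dirCoord_apply, framePoint, Matrix.cons_val_zero, Matrix.cons_val_one, Real.cos_sub]
  ring

theorem framePoint_sub_int_mul_two_pi (θ a b : ℝ) (n : ℤ) :
    framePoint (θ - n * (2 * Real.pi)) a b = framePoint θ a b := by
  simp [framePoint, Real.cos_sub_int_mul_two_pi, Real.sin_sub_int_mul_two_pi]

/-! ### Points on the boundary of a regular polygon -/

theorem regularPolygon_eq (k : ℕ) (R : ℝ) : regularPolygon k R =
    convexHull ℝ (Set.range fun i : Fin k => framePoint (2 * i * (Real.pi / k)) R 0) := by
  have h : ∀ i : Fin k, 2 * Real.pi * (i : ℝ) / (k : ℝ) = 2 * i * (Real.pi / k) := by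
    intro i; ring
  simp only [regularPolygon, framePoint, zero_mul, sub_zero, add_zero, h]

theorem vertex_mem_regularPolygon {k : ℕ} (hk : 0 < k) (R : ℝ) (m : ℕ) :
    framePoint (2 * m * (Real.pi / k)) R 0 ∈ regularPolygon k R := by
  rw [regularPolygon_eq]
  refine subset_convexHull ℝ _ ⟨⟨m % k, Nat.mod_lt m hk⟩, ?_⟩
  have hm : (m : ℝ) = (m % k : ℕ) + k * (m / k : ℕ) := by
    exact_mod_cast (Nat.mod_add_div m k).symm
  have hk' : (k : ℝ) ≠ 0 := by exact_mod_cast hk.ne'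
  simp only
  rw [← framePoint_sub_int_mul_two_pi (2 * m * (Real.pi / k)) R 0 ((m / k : ℕ) : ℤ)]
  congr 1
  rw [hm, Int.cast_natCast]
  field_simp
  ring

theorem cos_odd_mul_pi_div_le {k : ℕ} {m : ℤ} (hk : 0 < k) (hm : Odd m) (hmk : |m| < 2 * k) :
    Real.cos (m * (Real.pi / k)) ≤ Real.cos (Real.pi / k) := by
  have hk' : (0 : ℝ) < k := by exact_mod_cast hk
  have ha : 0 < Real.pi / k := by positivity
  have hka : k * (Real.pi / k) = Real.pi := by field_simp
  have hm1 : (1 : ℝ) ≤ |(m : ℝ)| := by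
    have : 1 ≤ |m| := Int.one_le_abs (by rintro rfl; simp at hm)
    exact_mod_cast this
  have hm2 : |(m : ℝ)| ≤ 2 * k - 1 := by
    have : |m| ≤ 2 * k - 1 := by omega
    exact_mod_cast this
  rw [← Real.cos_abs, abs_mul, abs_of_pos ha]
  rcases le_total |(m : ℝ)| k with h | h
  · refine Real.cos_le_cos_of_nonneg_of_le_pi ha.le ?_ (by nlinarith)
    nlinarith
  · rw [← Real.cos_two_pi_sub]
    exact Real.cos_le_cos_of_nonneg_of_le_pi ha.le (by nlinarith) (by nlinarith)

theorem dirCoord_le_of_mem_regularPolygon {k l : ℕ} {R : ℝ} (hR : 0 ≤ R) (hl : l < k) {x : Plane}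
    (hx : x ∈ regularPolygon k R) :
    dirCoord ((2 * l + 1) * (Real.pi / k)) x ≤ R * Real.cos (Real.pi / k) := by
  rw [regularPolygon_eq] at hx
  have hsub := convexHull_min (t := {x : Plane | dirCoord ((2 * l + 1) * (Real.pi / k)) x ≤
    R * Real.cos (Real.pi / k)}) (s := Set.range fun i : Fin k =>
      framePoint (2 * i * (Real.pi / k)) R 0) ?_ (convex_halfSpace_le (LinearMap.isLinear _) _)
  · exact hsub hx
  · rintro _ ⟨i, rfl⟩
    simp only [Set.mem_ofPred_eq, dirCoord_framePoint_zero]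
    refine mul_le_mul_of_nonneg_left ?_ hR
    have h := cos_odd_mul_pi_div_le (k := k) (m := 2 * (l - i) + 1) (by omega)
      ⟨_, rfl⟩ (by have := i.2; rw [abs_lt]; omega)
    rw [show (2 * (l : ℝ) + 1) * (Real.pi / k) - 2 * i * (Real.pi / k) =
      ((2 * (l - i) + 1 : ℤ) : ℝ) * (Real.pi / k) by push_cast; ring]
    exact h

/-- Such a point is a convex combination of the vertices `l` and `l + 1`, and any outward move along
the edge normal violates the supporting half-plane. -/
theorem mem_frontier_regularPolygon {k l : ℕ} {R : ℝ} (hk : 3 ≤ k) (hR : 0 < R) (hl : l < k)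
    {x : Plane} (hU : dirCoord ((2 * l + 1) * (Real.pi / k)) x = R * Real.cos (Real.pi / k))
    (hV : |dirCoord ((2 * l + 1) * (Real.pi / k) + Real.pi / 2) x| ≤
      R * Real.sin (Real.pi / k)) :
    x ∈ frontier (regularPolygon k R) := by
  set θ := (2 * l + 1) * (Real.pi / k) with hθ
  set v := dirCoord (θ + Real.pi / 2) x with hv
  have hs := sin_pi_div_pos hk
  have hb : 0 < R * Real.sin (Real.pi / k) := by positivity
  rw [abs_le] at hV
  refine ⟨subset_closure ?_, fun hint => ?_⟩
  · have h1 := vertex_mem_regularPolygon (show 0 < k by omega) R l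
    have h2 := vertex_mem_regularPolygon (show 0 < k by omega) R (l + 1)
    have hconv : Convex ℝ (regularPolygon k R) := convex_convexHull ℝ _
    set b := R * Real.sin (Real.pi / k) with hbdef
    have h3 := hconv h1 h2 (a := (b - v) / (2 * b)) (b := (v + b) / (2 * b))
      (div_nonneg (by linarith) (by linarith)) (div_nonneg (by linarith) (by linarith))
      (by field_simp; ring)
    convert h3
    have e1 : 2 * (l : ℝ) * (Real.pi / k) = θ + -(Real.pi / k) := by rw [hθ]; ring
    have e2 : 2 * ((l + 1 : ℕ) : ℝ) * (Real.pi / k) = θ + Real.pi / k := by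
      rw [hθ]; push_cast; ring
    rw [e1, e2]
    apply eq_of_dirCoord_eq θ
    · rw [map_add, map_smul, map_smul, dirCoord_framePoint_zero, dirCoord_framePoint_zero, hU]
      simp only [sub_add_cancel_left, neg_neg, Real.cos_neg, smul_eq_mul]
      field_simp
      ring
    · rw [map_add, map_smul, map_smul, dirCoord_framePoint_zero, dirCoord_framePoint_zero, ← hv,
        show θ + Real.pi / 2 - (θ + -(Real.pi / k)) = Real.pi / k + Real.pi / 2 by ring,
        show θ + Real.pi / 2 - (θ + Real.pi / k) = Real.pi / 2 - Real.pi / k by ring,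
        Real.cos_add_pi_div_two, Real.cos_pi_div_two_sub]
      simp only [smul_eq_mul, mul_neg, ← hbdef]
      field_simp
      ring
  · rw [mem_interior_iff_mem_nhds, Metric.mem_nhds_iff] at hint
    obtain ⟨ε, hε, hball⟩ := hint
    have h1 : x + framePoint θ (ε / 2) 0 ∈ ball x ε := by
      rw [mem_ball, dist_eq_norm, add_sub_cancel_left, ← sq_lt_sq₀ (norm_nonneg _) hε.le,
        norm_framePoint_sq]
      nlinarith
    have h2 := dirCoord_le_of_mem_regularPolygon hR.le hl (hball h1)
    rw [map_add, dirCoord_framePoint, hU] at h2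
    linarith

/-! ### Discs inside the hull of the edge midpoints -/

theorem exists_cos_sub_ge {k : ℕ} (hk : 0 < k) (φ : ℝ) :
    ∃ l < k, Real.cos (Real.pi / k) ≤ Real.cos (φ - (2 * l + 1) * (Real.pi / k)) := by
  have hk' : (0 : ℝ) < k := by exact_mod_cast hk
  have ha : 0 < Real.pi / k := by positivity
  set u : ℝ := Int.fract (φ / (2 * Real.pi)) * k with hu
  have hu0 : 0 ≤ u := mul_nonneg (Int.fract_nonneg _) hk'.le
  have huk : u < k := by
    have := Int.fract_lt_one (φ / (2 * Real.pi)); nlinarith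
  refine ⟨⌊u⌋₊, (Nat.floor_lt hu0).mpr huk, ?_⟩
  have hφ : φ = u * (2 * (Real.pi / k)) + ⌊φ / (2 * Real.pi)⌋ * (2 * Real.pi) := by
    have h1 := Int.fract_add_floor (φ / (2 * Real.pi))
    have h2 : φ = (Int.fract (φ / (2 * Real.pi)) + ⌊φ / (2 * Real.pi)⌋) * (2 * Real.pi) := by
      rw [h1]; field_simp
    conv_lhs => rw [h2]
    rw [hu]
    field_simp
  have h1 : φ - (2 * (⌊u⌋₊ : ℝ) + 1) * (Real.pi / k) =
      (2 * (u - ⌊u⌋₊) - 1) * (Real.pi / k) + ⌊φ / (2 * Real.pi)⌋ * (2 * Real.pi) := by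
    linear_combination hφ
  rw [h1, Real.cos_add_int_mul_two_pi, ← Real.cos_abs (_ * _)]
  have h2 := Nat.floor_le hu0
  have h3 := Nat.lt_floor_add_one u
  refine Real.cos_le_cos_of_nonneg_of_le_pi (abs_nonneg _) ?_ ?_
  · exact div_le_self Real.pi_pos.le (by exact_mod_cast hk)
  · rw [abs_mul, abs_of_pos ha]
    have : |2 * (u - ⌊u⌋₊) - 1| ≤ 1 := abs_le.mpr ⟨by linarith, by linarith⟩
    nlinarith

/-- A functional separating a point of the disk from `K` has a direction within angle π/k of some
midpoint, where it is at least H cos(π/k) times its norm, hence no smaller than on the disk. -/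
theorem closedBall_subset_of_midpoints {k : ℕ} {H : ℝ} {K : Set Plane} (hk : 0 < k) (hH : 0 ≤ H)
    (hconv : Convex ℝ K) (hcl : IsClosed K)
    (hK : ∀ l < k, framePoint ((2 * l + 1) * (Real.pi / k)) H 0 ∈ K) :
    closedBall 0 (H * Real.cos (Real.pi / k)) ⊆ K := by
  intro y hy
  by_contra hyK
  rw [mem_closedBall_zero_iff] at hy
  obtain ⟨f, u, hu, huy⟩ := geometric_hahn_banach_closed_point hconv hcl hyK
  set g : Plane := !₂[f (EuclideanSpace.single 0 1), f (EuclideanSpace.single 1 1)] with hg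
  obtain ⟨φ, h0, h1⟩ := exists_polar_angle g
  have hf : ∀ x : Plane, f x = ‖g‖ * dirCoord φ x := by
    intro x
    have hx : x = x 0 • EuclideanSpace.single 0 1 + x 1 • EuclideanSpace.single 1 1 := by
      ext i; fin_cases i <;> simp
    have e0 : f (EuclideanSpace.single 0 1) = ‖g‖ * Real.cos φ := by rw [← h0, hg]; simp
    have e1 : f (EuclideanSpace.single 1 1) = ‖g‖ * Real.sin φ := by rw [← h1, hg]; simp
    conv_lhs => rw [hx]
    rw [map_add, map_smul, map_smul, e0, e1, dirCoord_apply, smul_eq_mul, smul_eq_mul]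
    ring
  obtain ⟨l, hl, hcos⟩ := exists_cos_sub_ge hk φ
  have h2 := hu _ (hK l hl)
  rw [hf, dirCoord_framePoint_zero] at h2
  rw [hf] at huy
  have h3 := (le_abs_self _).trans ((abs_dirCoord_le φ y).trans hy)
  have h4 := mul_le_mul_of_nonneg_left (h3.trans (mul_le_mul_of_nonneg_left hcos hH))
    (norm_nonneg g)
  linarith

/-! ### Peeling the nested configuration -/

theorem notMem_convexLayer_of_openSegment {d : ℕ} {Z : Finset (EuclideanSpace ℝ (Fin d))}
    {x y z : EuclideanSpace ℝ (Fin d)}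
    (hy : y ∈ convexHull ℝ (Z : Set (EuclideanSpace ℝ (Fin d))))
    (hz : z ∈ convexHull ℝ (Z : Set (EuclideanSpace ℝ (Fin d))))
    (hx : x ∈ openSegment ℝ y z) (hne : y ≠ x) : x ∉ convexLayer Z := by
  intro h
  rw [← Finset.mem_coe, coe_convexLayer, mem_extremePoints] at h
  exact hne (h.2 y hy z hz hx).1

/-- The configuration points strictly inside the `j`-th polygon, and those on the `j`-th polygon
that are left when the `t` outermost ones have been removed at both ends of each edge, belong
to `Z`. -/
def ContainsCore (k : ℕ) (ρ : ℝ) (j t : ℕ) (Z : Finset Plane) : Prop :=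
  ∀ l < k, ∀ j' : ℕ, 1 ≤ j' → ∀ i : ℤ, Even (i + j') →
    (j' < j ∧ |i| ≤ halfWidth k j' ∨ j' = j ∧ |i| ≤ halfWidth k j - 2 * t) →
    edgePoint k ρ l j' i ∈ Z

theorem edgePoint_eq_add {k : ℕ} {ρ : ℝ} (l j : ℕ) (i e : ℤ) :
    edgePoint k ρ l j (i + e) = edgePoint k ρ l j i +
      framePoint ((2 * l + 1) * (Real.pi / k)) 0 (e * (23 / 40 * (ρ * Real.cos (Real.pi / k)))) := by
  apply eq_of_dirCoord_eq ((2 * l + 1) * (Real.pi / k))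
  · simp [edgePoint, dirCoord_framePoint]
  · simp only [edgePoint, dirCoord_framePoint_perp, map_add]
    push_cast
    ring

theorem norm_edgePoint_le {k j : ℕ} {i : ℤ} {ρ : ℝ} (l : ℕ) (hρ : 0 < ρ) (hk : 3 ≤ k)
    (hi : |i| ≤ halfWidth k j) : ‖edgePoint k ρ l j i‖ ≤ j * ρ := by
  have hc := cos_pi_div_pos hk
  have hs := sin_pi_div_pos hk
  have h := edgePoint_mem_sector l hρ hc hi
  rw [← sq_le_sq₀ (norm_nonneg _) (by positivity), norm_sq_eq_dirCoord ((2 * l + 1) * (Real.pi / k))]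
  set v := dirCoord ((2 * l + 1) * (Real.pi / k) + Real.pi / 2) (edgePoint k ρ l j i)
  have hU : dirCoord ((2 * l + 1) * (Real.pi / k)) (edgePoint k ρ l j i) =
      j * (ρ * Real.cos (Real.pi / k)) := dirCoord_framePoint _ _ _
  rw [hU] at h ⊢
  have h1 : |v| ≤ j * ρ * Real.sin (Real.pi / k) := by
    refine le_of_mul_le_mul_right ?_ hc
    have : 0 ≤ 23 / 20 * (ρ * Real.cos (Real.pi / k)) / 2 := by positivity
    linarith
  have h2 : v ^ 2 ≤ (j * ρ * Real.sin (Real.pi / k)) ^ 2 := by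
    rw [← sq_abs v]; gcongr
  have h3 : (j * ρ) ^ 2 * (Real.sin (Real.pi / k) ^ 2 + Real.cos (Real.pi / k) ^ 2) =
      (j * ρ) ^ 2 := by rw [Real.sin_sq_add_cos_sq, mul_one]
  linarith

theorem ContainsCore.midpoint_mem {k j t : ℕ} {ρ : ℝ} {Z : Finset Plane}
    (hZ : ContainsCore k ρ j t Z) (hj : 1 ≤ j) (ht : 1 ≤ halfWidth k j - 2 * t) :
    ∀ l < k, framePoint ((2 * l + 1) * (Real.pi / k)) (j * (ρ * Real.cos (Real.pi / k))) 0 ∈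
      convexHull ℝ (Z : Set Plane) := by
  intro l hl
  have hzero : framePoint ((2 * l + 1) * (Real.pi / k)) (j * (ρ * Real.cos (Real.pi / k))) 0 =
      edgePoint k ρ l j 0 := by simp [edgePoint]
  rw [hzero]
  -- For odd `j` the midpoint is not a configuration point, but it bisects the points with indices 1
  -- and -1; hence the requirement that the remaining width be at least 1.
  rcases Nat.even_or_odd j with hev | hodd
  · refine subset_convexHull ℝ _ (hZ l hl j hj 0 (by simpa using hev) (Or.inr ⟨rfl, ?_⟩))
    simp only [abs_zero]; omega
  · have h1 := hZ l hl j hj 1 (by rw [add_comm]; exact_mod_cast hodd.add_one)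
      (Or.inr ⟨rfl, by simpa using ht⟩)
    have h2 := hZ l hl j hj (-1) (by
      have : Odd (j : ℤ) := by exact_mod_cast hodd
      exact (Odd.neg odd_one).add_odd this) (Or.inr ⟨rfl, by simpa using ht⟩)
    rw [← zero_add (1 : ℤ), edgePoint_eq_add] at h1
    rw [← zero_add (-1 : ℤ), edgePoint_eq_add] at h2
    have := (convex_convexHull ℝ (Z : Set Plane)) (subset_convexHull ℝ _ h1)
      (subset_convexHull ℝ _ h2) (show (0 : ℝ) ≤ 1 / 2 by norm_num)
      (show (0 : ℝ) ≤ 1 / 2 by norm_num) (by norm_num)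
    convert this using 1
    have e : ∀ θ b : ℝ, framePoint θ 0 (-b) = -framePoint θ 0 b := by
      intro θ b
      ext i; fin_cases i <;> simp [framePoint]
    push_cast
    rw [neg_one_mul, e, one_mul]
    module

theorem framePoint_ne_zero {θ a b : ℝ} (h : a ≠ 0 ∨ b ≠ 0) : framePoint θ a b ≠ 0 := by
  intro h0
  have h1 := dirCoord_framePoint θ a b
  have h2 := dirCoord_framePoint_perp θ a b
  rw [h0, map_zero] at h1 h2
  rcases h with h | h
  · exact h h1.symm
  · exact h h2.symm

/-- Points on smaller polygons are interior to the disk inscribed in the hull of the edge midpoints,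
by `hjs`. A point on the j-th polygon within the reduced width is the midpoint of its neighbours
with indices i ± 2, both still present. -/
theorem ContainsCore.peel {X : Finset Plane} {k j t q : ℕ} {ρ : ℝ} (hρ : 0 < ρ) (hk : 3 ≤ k)
    (hj : 1 ≤ j) (hcore : ContainsCore k ρ j t (peelingSeq X q))
    (ht : 1 ≤ halfWidth k j - 2 * t) (hjs : j * Real.sin (Real.pi / k) ^ 2 < 1) :
    ContainsCore k ρ j (t + 1) (peelingSeq X (q + 1)) := by
  have hc := cos_pi_div_pos hk
  intro l hl j' hj' i hev hcase
  rw [peelingSeq_succ]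
  refine ⟨hcore l hl j' hj' i hev ?_, ?_⟩
  · rcases hcase with h | ⟨h1, h2⟩
    · exact Or.inl h
    · push_cast at h2
      exact Or.inr ⟨h1, by omega⟩
  rcases hcase with ⟨hlt, hi⟩ | ⟨rfl, hi⟩
  · have hball := closedBall_subset_of_midpoints (show 0 < k by omega)
      (show 0 ≤ j * (ρ * Real.cos (Real.pi / k)) by positivity) (convex_convexHull ℝ _)
      ((peelingSeq X q).finite_toSet.isClosed_convexHull ℝ) (hcore.midpoint_mem hj ht)
    have hn := norm_edgePoint_le l hρ hk hi
    set x := edgePoint k ρ l j' i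
    have hgap : (j' : ℝ) * ρ < j * (ρ * Real.cos (Real.pi / k)) * Real.cos (Real.pi / k) := by
      have h1 : (j' : ℝ) + 1 ≤ j := by exact_mod_cast hlt
      have h2 : (j : ℝ) * Real.cos (Real.pi / k) ^ 2 = j - j * Real.sin (Real.pi / k) ^ 2 := by
        rw [Real.cos_sq']; ring
      have h3 : (j' : ℝ) < j * Real.cos (Real.pi / k) ^ 2 := by linarith
      have := mul_lt_mul_of_pos_right h3 hρ
      linarith
    set D := j * (ρ * Real.cos (Real.pi / k)) * Real.cos (Real.pi / k)
    set ε := D - j' * ρ with hε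
    have hε0 : 0 < ε := by linarith
    have hv : ‖framePoint 0 ε 0‖ = ε := by
      rw [← sq_eq_sq₀ (norm_nonneg _) hε0.le, norm_framePoint_sq]; ring
    refine notMem_convexLayer_of_openSegment (hball ?_) (hball ?_)
      (mem_openSegment_sub_add x (framePoint 0 ε 0)) ?_
    · rw [mem_closedBall_zero_iff]
      exact (norm_sub_le _ _).trans (by rw [hv]; linarith)
    · rw [mem_closedBall_zero_iff]
      exact (norm_add_le _ _).trans (by rw [hv]; linarith)
    · rw [Ne, sub_eq_self]
      exact framePoint_ne_zero (Or.inl hε0.ne')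
  · push_cast at hi
    rw [abs_le] at hi
    have h1 := hcore l hl j' hj' (i + 2) (by rw [add_right_comm]; exact hev.add even_two)
      (Or.inr ⟨rfl, abs_le.mpr ⟨by omega, by omega⟩⟩)
    have h2 := hcore l hl j' hj' (i - 2) (by rw [sub_add_eq_add_sub]; exact hev.sub even_two)
      (Or.inr ⟨rfl, abs_le.mpr ⟨by omega, by omega⟩⟩)
    rw [edgePoint_eq_add] at h1
    have e := edgePoint_eq_add (k := k) (ρ := ρ) l j' (i - 2) 2
    rw [sub_add_cancel, ← sub_eq_iff_eq_add] at e
    rw [← e] at h2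
    refine notMem_convexLayer_of_openSegment (subset_convexHull ℝ _ h2) (subset_convexHull ℝ _ h1)
      (mem_openSegment_sub_add _ _) ?_
    rw [Ne, sub_eq_self]
    refine framePoint_ne_zero (Or.inr ?_)
    push_cast
    positivity

theorem ContainsCore.nonempty {k j t : ℕ} {ρ : ℝ} {Z : Finset Plane} (hk : 0 < k)
    (hZ : ContainsCore k ρ j t Z) (hj : 1 ≤ j) (ht : 1 ≤ halfWidth k j - 2 * t) : Z.Nonempty := by
  have h := hZ.midpoint_mem hj ht 0 hk
  exact Finset.coe_nonempty.mp (convexHull_nonempty_iff.mp ⟨_, h⟩)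

theorem ContainsCore.sum_le_layerNumber {X : Finset Plane} {k : ℕ} {ρ : ℝ} (hρ : 0 < ρ)
    (hk : 3 ≤ k) (j : ℕ) (hjs : j * Real.sin (Real.pi / k) ^ 2 < 1) (q : ℕ)
    (hq : q ≤ layerNumber X) (hcore : ContainsCore k ρ j 0 (peelingSeq X q)) :
    q + ∑ m ∈ Finset.Icc 1 j, ((halfWidth k m + 1) / 2).toNat ≤ layerNumber X := by
  induction j generalizing q with
  | zero => simpa using hq
  | succ j ih =>
    -- This is the number of t ≥ 0 for which the remaining width `halfWidth k (j + 1) - 2 * t` is at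
    -- least 1; it is 0 for a small polygon with nonpositive width.
    set T := ((halfWidth k (j + 1) + 1) / 2).toNat with hT
    have key : ∀ t ≤ T, q + t ≤ layerNumber X ∧
        ContainsCore k ρ (j + 1) t (peelingSeq X (q + t)) := by
      intro t
      induction t with
      | zero => exact fun _ => ⟨hq, hcore⟩
      | succ t iht =>
        intro htT
        obtain ⟨h1, h2⟩ := iht (by omega)
        have ht : 1 ≤ halfWidth k (j + 1) - 2 * t := by omega
        refine ⟨?_, h2.peel hρ hk (by omega) ht hjs⟩
        have hne := h2.nonempty (by omega) (by omega) ht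
        rcases h1.lt_or_eq with h | h
        · omega
        · rw [h, peelingSeq_layerNumber] at hne
          simp at hne
    obtain ⟨h1, h2⟩ := key T le_rfl
    rw [Finset.sum_Icc_succ_top (by omega), ← hT]
    have h3 := ih (by
      refine lt_of_le_of_lt ?_ hjs
      push_cast
      nlinarith [sq_nonneg (Real.sin (Real.pi / k))]) (q + T) h1 (by
        intro l hl j' hj' i hev hcase
        refine h2 l hl j' hj' i hev (Or.inl ?_)
        rcases hcase with ⟨h, h'⟩ | ⟨rfl, h'⟩
        · exact ⟨by omega, h'⟩
        · exact ⟨by omega, by simpa using h'⟩)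
    omega

theorem sum_le_layerNumber_nestedPoints {k J : ℕ} {ρ : ℝ} (hρ : 0 < ρ) (hk : 3 ≤ k)
    (hJ : J * Real.sin (Real.pi / k) ^ 2 < 1) :
    ∑ m ∈ Finset.Icc 1 J, ((halfWidth k m + 1) / 2).toNat ≤
      layerNumber (nestedPoints k ρ J) := by
  have h := ContainsCore.sum_le_layerNumber (X := nestedPoints k ρ J) hρ hk J hJ 0 (Nat.zero_le _) (by
    intro l hl j' hj' i hev hcase
    refine mem_nestedPoints.mpr ⟨l, hl, j', hj', ?_, i, ?_, hev, rfl⟩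
    · rcases hcase with h | h <;> omega
    · rcases hcase with h | ⟨rfl, h⟩
      · exact h.2
      · simpa using h)
  simpa using h

/-! ### Counting -/

theorem le_card_filter_even_add (M : ℤ) (c : ℕ) :
    M ≤ ((Finset.Icc (-M) M).filter fun i : ℤ => Even (i + (c : ℤ))).card := by
  rcases lt_or_ge M 0 with hM | hM
  · exact hM.le.trans (Int.natCast_nonneg _)
  obtain ⟨e, he, hev⟩ : ∃ e : ℤ, (e = 0 ∨ e = 1) ∧ Even (-M + e + c) := by
    rcases Int.even_or_odd (-M + c) with h | h
    · exact ⟨0, Or.inl rfl, by simpa using h⟩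
    · exact ⟨1, Or.inr rfl, by rw [add_right_comm]; exact h.add_one⟩
  have h := Finset.card_le_card_of_injOn (s := Finset.range M.toNat)
    (t := (Finset.Icc (-M) M).filter fun i : ℤ => Even (i + (c : ℤ))) (fun q => -M + e + 2 * (q : ℤ)) ?_ ?_
  · rw [Finset.card_range] at h
    omega
  · intro q hq
    rw [Finset.mem_coe, Finset.mem_range] at hq
    simp only [Finset.coe_filter, Finset.mem_Icc, Set.mem_ofPred_eq]
    refine ⟨by omega, ?_⟩
    rw [add_right_comm]
    exact hev.add (even_two_mul _)
  · intro q _ q' _ h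
    simp only at h
    omega

theorem card_nestedPoints_ge {k J : ℕ} {ρ : ℝ} (hρ : 0 < ρ) (hk : 3 ≤ k) :
    (k : ℤ) * ∑ j ∈ Finset.Icc 1 J, halfWidth k j ≤ (nestedPoints k ρ J).card := by
  classical
  have hc := cos_pi_div_pos hk
  have hinj : Set.InjOn (fun q : Σ _ : ℕ × ℕ, ℤ => edgePoint k ρ q.1.1 q.1.2 q.2)
      (nestedIndex k J) := by
    rintro ⟨⟨l, j⟩, i⟩ h ⟨⟨l', j'⟩, i'⟩ h' heq
    simp only [nestedIndex, Finset.coe_sigma, Set.mem_sigma_iff, Finset.mem_coe,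
      Finset.mem_product, Finset.mem_range, Finset.mem_Icc, Finset.mem_filter, ← abs_le] at h h'
    simp only at heq
    by_contra hne
    have h1 := edgePoint_separated hρ hk h.1.1 h'.1.1 h.2.1 h'.2.1 h.2.2 h'.2.2
      (by rintro ⟨rfl, rfl, rfl⟩; exact hne rfl)
    rw [heq, dist_self] at h1
    have : 0 < 23 / 20 * (ρ * Real.cos (Real.pi / k)) := by positivity
    linarith
  rw [nestedPoints, Finset.card_image_of_injOn hinj, nestedIndex, Finset.card_sigma]
  push_cast
  rw [Finset.sum_product]
  calc (k : ℤ) * ∑ j ∈ Finset.Icc 1 J, halfWidth k j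
      = ∑ _l ∈ Finset.range k, ∑ j ∈ Finset.Icc 1 J, halfWidth k j := by simp
    _ ≤ _ := Finset.sum_le_sum fun l _ => Finset.sum_le_sum fun j _ =>
        le_card_filter_even_add (halfWidth k j) j

/-- Uses tan a ≥ a for a = π/k; of the loss 3, at most 2 comes from 1/cos a and 1 from the floor. -/
theorem halfWidth_ge {k : ℕ} (hk : 3 ≤ k) (j : ℕ) :
    40 / 23 * (Real.pi / k) * j - 3 ≤ (halfWidth k j : ℝ) := by
  have hk' : (3 : ℝ) ≤ k := by exact_mod_cast hk
  have ha : 0 ≤ Real.pi / k := by positivity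
  have ha3 : Real.pi / k ≤ Real.pi / 3 :=
    div_le_div_of_nonneg_left Real.pi_pos.le (by norm_num) hk'
  have hc : 1 / 2 ≤ Real.cos (Real.pi / k) := by
    rw [← Real.cos_pi_div_three]
    exact Real.cos_le_cos_of_nonneg_of_le_pi ha (by linarith [Real.pi_pos]) ha3
  have htan : Real.pi / k * Real.cos (Real.pi / k) ≤ Real.sin (Real.pi / k) := by
    rw [← le_div_iff₀ (by linarith), ← Real.tan_eq_sin_div_cos]
    exact Real.le_tan ha (by linarith [Real.pi_pos])
  have h1 : 40 / 23 * (Real.pi / k) * j - 2 ≤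
      (40 / 23 * j * Real.sin (Real.pi / k) - 1) / Real.cos (Real.pi / k) := by
    rw [le_div_iff₀ (by linarith)]
    have := mul_le_mul_of_nonneg_left htan (Nat.cast_nonneg (α := ℝ) j)
    linarith
  have h2 := Int.lt_floor_add_one
    ((40 / 23 * j * Real.sin (Real.pi / k) - 1) / Real.cos (Real.pi / k))
  rw [halfWidth]
  linarith

theorem sum_Icc_ge_of_affine_le {f : ℕ → ℝ} {c d : ℝ} (hc : 0 ≤ c) (h : ∀ j, c * j - d ≤ f j)
    (J : ℕ) : c * J ^ 2 / 2 - d * J ≤ ∑ j ∈ Finset.Icc 1 J, f j := by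
  induction J with
  | zero => simp
  | succ J ih =>
    rw [Finset.sum_Icc_succ_top (by omega)]
    have := h (J + 1)
    push_cast at this ⊢
    linarith

theorem nestedPoints_separated {k J : ℕ} {ρ : ℝ} (hρ : 0 < ρ) (hk : 3 ≤ k) :
    ∀ x ∈ nestedPoints k ρ J, ∀ y ∈ nestedPoints k ρ J, x ≠ y →
      23 / 20 * (ρ * Real.cos (Real.pi / k)) ≤ dist x y := by
  intro x hx y hy hxy
  obtain ⟨l, hl, j, -, -, i, hi, hp, rfl⟩ := mem_nestedPoints.mp hx
  obtain ⟨l', hl', j', -, -, i', hi', hp', rfl⟩ := mem_nestedPoints.mp hy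
  exact edgePoint_separated hρ hk hl hl' hi hi' hp hp' (by rintro ⟨rfl, rfl, rfl⟩; exact hxy rfl)

theorem nestedPoints_mem_frontier {k J : ℕ} {ρ : ℝ} (hρ : 0 < ρ) (hk : 3 ≤ k) :
    ∀ x ∈ nestedPoints k ρ J, ∃ j : ℕ, 1 ≤ j ∧ j ≤ J ∧ x ∈ frontier (regularPolygon k (j * ρ)) := by
  intro x hx
  obtain ⟨l, hl, j, hj, hjJ, i, hi, hp, rfl⟩ := mem_nestedPoints.mp hx
  have hc := cos_pi_div_pos hk
  have hj' : (0 : ℝ) < j := by exact_mod_cast hj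
  have hU : dirCoord ((2 * l + 1) * (Real.pi / k)) (edgePoint k ρ l j i) =
      j * (ρ * Real.cos (Real.pi / k)) := dirCoord_framePoint _ _ _
  refine ⟨j, hj, hjJ, mem_frontier_regularPolygon hk (by positivity) hl (by rw [hU]; ring) ?_⟩
  have h := edgePoint_mem_sector l hρ hc hi
  rw [hU] at h
  refine le_of_mul_le_mul_right ?_ hc
  have : 0 ≤ 23 / 20 * (ρ * Real.cos (Real.pi / k)) / 2 := by positivity
  linarith

theorem nestedPoints_subset_closedBall {k J : ℕ} {ρ : ℝ} (hρ : 0 < ρ) (hk : 3 ≤ k)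
    (hJ : J * ρ ≤ 1) : (nestedPoints k ρ J : Set Plane) ⊆ closedBall 0 1 := by
  intro x hx
  obtain ⟨l, hl, j, hj, hjJ, i, hi, hp, rfl⟩ := mem_nestedPoints.mp hx
  rw [mem_closedBall_zero_iff]
  have hjJ' : (j : ℝ) ≤ J := by exact_mod_cast hjJ
  exact (norm_edgePoint_le l hρ hk hi).trans ((by gcongr : (j : ℝ) * ρ ≤ J * ρ).trans hJ)

theorem card_nestedPoints_ge_real {k J : ℕ} {ρ : ℝ} (hρ : 0 < ρ) (hk : 3 ≤ k) :
    20 / 23 * Real.pi * J ^ 2 - 3 * k * J ≤ ((nestedPoints k ρ J).card : ℝ) := by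
  have h1 : (k : ℝ) * ∑ j ∈ Finset.Icc 1 J, (halfWidth k j : ℝ) ≤ (nestedPoints k ρ J).card := by
    exact_mod_cast card_nestedPoints_ge hρ hk
  have hk' : (0 : ℝ) < k := by exact_mod_cast (by omega : 0 < k)
  have h2 := sum_Icc_ge_of_affine_le (by positivity) (halfWidth_ge hk) J
  have h3 := mul_le_mul_of_nonneg_left h2 hk'.le
  refine le_trans (le_of_eq ?_) (h3.trans h1)
  field_simp
  ring

theorem layerNumber_nestedPoints_ge {k J : ℕ} {ρ : ℝ} (hρ : 0 < ρ) (hk : 3 ≤ k)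
    (hJ : J * Real.sin (Real.pi / k) ^ 2 < 1) :
    10 / 23 * (Real.pi / k) * J ^ 2 - 3 / 2 * J ≤ (layerNumber (nestedPoints k ρ J) : ℝ) := by
  have h1 : ((∑ m ∈ Finset.Icc 1 J, ((halfWidth k m + 1) / 2).toNat : ℕ) : ℝ) ≤
      layerNumber (nestedPoints k ρ J) := by
    exact_mod_cast sum_le_layerNumber_nestedPoints hρ hk hJ
  rw [Nat.cast_sum] at h1
  have h2 := sum_Icc_ge_of_affine_le (f := fun m => (((halfWidth k m + 1) / 2).toNat : ℝ))
    (c := 20 / 23 * (Real.pi / k)) (d := 3 / 2) (by positivity) (fun j => ?_) J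
  · linarith
  · have h3 := halfWidth_ge hk j
    have h4 : halfWidth k j ≤ 2 * (((halfWidth k j + 1) / 2).toNat : ℤ) := by omega
    have h5 : (halfWidth k j : ℝ) ≤ 2 * (((halfWidth k j + 1) / 2).toNat : ℝ) := by
      exact_mod_cast h4
    linarith

/-! ### Choice of parameters and conclusion. -/

theorem nestedPoints_sharp {α : ℝ} (hα : 1 < α) {w : ℝ} (hw : 100000 ≤ w) :
    IsEvenlyDistributed α (nestedPoints ⌊w⌋₊ (20 / w ^ 2) ⌊w ^ 2 / 20⌋₊) ∧
    (∀ x ∈ nestedPoints ⌊w⌋₊ (20 / w ^ 2) ⌊w ^ 2 / 20⌋₊, ∃ j : ℕ, 1 ≤ j ∧ j ≤ ⌊w ^ 2 / 20⌋₊ ∧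
      x ∈ frontier (regularPolygon ⌊w⌋₊ (j * (20 / w ^ 2)))) ∧
    (∀ x ∈ nestedPoints ⌊w⌋₊ (20 / w ^ 2) ⌊w ^ 2 / 20⌋₊,
      ∀ y ∈ nestedPoints ⌊w⌋₊ (20 / w ^ 2) ⌊w ^ 2 / 20⌋₊, x ≠ y → 20 / w ^ 2 ≤ dist x y) ∧
    1 / 1000 * w ^ 4 ≤ ((nestedPoints ⌊w⌋₊ (20 / w ^ 2) ⌊w ^ 2 / 20⌋₊).card : ℝ) ∧
    ((nestedPoints ⌊w⌋₊ (20 / w ^ 2) ⌊w ^ 2 / 20⌋₊).card : ℝ) ≤ 1 * w ^ 4 ∧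
    1 / 1000 * w ^ 3 ≤ (layerNumber (nestedPoints ⌊w⌋₊ (20 / w ^ 2) ⌊w ^ 2 / 20⌋₊) : ℝ) := by
  have hw0 : 0 < w := by linarith
  have hw2 : 0 < w ^ 2 := by positivity
  have hw2' : 100000 * w ≤ w ^ 2 := by nlinarith
  have hkw : (⌊w⌋₊ : ℝ) ≤ w := Nat.floor_le hw0.le
  have hkw' : w < ⌊w⌋₊ + 1 := Nat.lt_floor_add_one w
  have hJw : (⌊w ^ 2 / 20⌋₊ : ℝ) ≤ w ^ 2 / 20 := Nat.floor_le (by positivity)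
  have hJw' : w ^ 2 / 20 < ⌊w ^ 2 / 20⌋₊ + 1 := Nat.lt_floor_add_one _
  generalize ⌊w⌋₊ = k at *
  generalize ⌊w ^ 2 / 20⌋₊ = J at *
  have hk : 3 ≤ k := by
    have : (3 : ℝ) ≤ k := by linarith
    exact_mod_cast this
  have hρ : 0 < 20 / w ^ 2 := by positivity
  have hk0 : (0 : ℝ) < k := by linarith
  have ha0 : 0 < Real.pi / k := by positivity
  have ha : Real.pi / k ≤ 4 / k := by gcongr; exact Real.pi_le_four
  have haw : 3 / w ≤ Real.pi / k := by
    have := Real.pi_gt_three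
    gcongr
  have ha1 : Real.pi / k ≤ 1 / 1000 := by
    refine ha.trans ?_
    rw [div_le_div_iff₀ hk0 (by norm_num)]
    linarith
  have hc : 999 / 1000 ≤ Real.cos (Real.pi / k) := by
    have := Real.one_sub_sq_div_two_le_cos (x := Real.pi / k)
    nlinarith
  have hc1 := Real.cos_le_one (Real.pi / k)
  have hsin : J * Real.sin (Real.pi / k) ^ 2 < 1 := by
    have h1 : Real.sin (Real.pi / k) ^ 2 ≤ (4 / k) ^ 2 :=
      pow_le_pow_left₀ (sin_pi_div_pos hk).le ((Real.sin_le ha0.le).trans ha) 2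
    have h2 : (99 / 100 * w) ^ 2 ≤ (k : ℝ) ^ 2 := by gcongr; linarith
    calc J * Real.sin (Real.pi / k) ^ 2 ≤ (w ^ 2 / 20) * (4 / k) ^ 2 := by gcongr
      _ < 1 := by
        rw [div_pow, mul_div_assoc', div_lt_one (by positivity)]
        linarith
  have hsep := nestedPoints_separated (J := J) hρ hk
  have hsep' : ∀ x ∈ nestedPoints k (20 / w ^ 2) J, ∀ y ∈ nestedPoints k (20 / w ^ 2) J, x ≠ y →
      20 / w ^ 2 ≤ dist x y := by
    intro x hx y hy hxy
    refine le_trans ?_ (hsep x hx y hy hxy)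
    nlinarith
  have hball := nestedPoints_subset_closedBall (J := J) hρ hk
    (by rw [mul_div_assoc', div_le_one hw2]; linarith)
  have hcard := card_nestedPoints_ge_real (J := J) hρ hk
  have hJ1 : 999 / 1000 * (w ^ 2 / 20) ≤ J := by nlinarith
  have hJ2 : (999 / 1000 * (w ^ 2 / 20)) ^ 2 ≤ (J : ℝ) ^ 2 := by gcongr
  have hkJ : (k : ℝ) * J ≤ w * (w ^ 2 / 20) := by gcongr
  have hw3 : 100000 * w ^ 3 ≤ w ^ 4 := by nlinarith [show 0 < w ^ 3 by positivity]
  have hpi := Real.pi_gt_d2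
  set N : ℝ := ((nestedPoints k (20 / w ^ 2) J).card : ℝ) with hN
  refine ⟨?_, nestedPoints_mem_frontier hρ hk, hsep', ?_, ?_, ?_⟩
  · refine isEvenlyDistributed_of_separated (s := 23 / 20 * (20 / w ^ 2 * Real.cos (Real.pi / k)))
      (by positivity) ⟨0, hball⟩ hsep ?_
    -- To leading order π|X| is π²w⁴/460 and s² is 529/w⁴. The rounded constants here and in `hs`
    -- multiply to about 11.24, still above 10; the lower bound on `w` absorbs the error terms.
    have hN1 : 2133 / 1000 * w ^ 4 / 100 ≤ Real.pi * N := by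
      have e1 : Real.pi * (20 / 23 * Real.pi * J ^ 2 - 3 * k * J) ≤ Real.pi * N :=
        mul_le_mul_of_nonneg_left hcard Real.pi_pos.le
      have e2 : (314 / 100 : ℝ) ^ 2 ≤ Real.pi ^ 2 := by gcongr; linarith
      have e3 : (314 / 100 : ℝ) ^ 2 * (999 / 1000 * (w ^ 2 / 20)) ^ 2 ≤ Real.pi ^ 2 * J ^ 2 :=
        mul_le_mul e2 hJ2 (by positivity) (by positivity)
      have e4 : Real.pi * (k * J) ≤ 4 * (w * (w ^ 2 / 20)) :=
        mul_le_mul Real.pi_le_four hkJ (by positivity) (by norm_num)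
      linarith [show 0 < w ^ 4 by positivity]
    have hs : (527 : ℝ) / w ^ 4 ≤ (23 / 20 * (20 / w ^ 2 * Real.cos (Real.pi / k))) ^ 2 := by
      have e1 : (999 / 1000 : ℝ) ^ 2 ≤ Real.cos (Real.pi / k) ^ 2 := by gcongr
      rw [show (23 / 20 * (20 / w ^ 2 * Real.cos (Real.pi / k))) ^ 2 =
        529 * Real.cos (Real.pi / k) ^ 2 / w ^ 4 by field_simp; ring]
      gcongr
      linarith
    have hprod := mul_le_mul hN1 hs (by positivity) (by positivity)
    have e5 : 2133 / 1000 * w ^ 4 / 100 * (527 / w ^ 4) = 2133 * 527 / 100000 := by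
      field_simp; norm_num
    rw [e5] at hprod
    have hpos : 10 < Real.pi * N * (23 / 20 * (20 / w ^ 2 * Real.cos (Real.pi / k))) ^ 2 :=
      lt_of_lt_of_le (by norm_num) hprod
    refine hpos.trans_le ((le_mul_of_one_le_left (by linarith) hα.le).trans (le_of_eq ?_))
    ring
  · have e1 : 3 * (J : ℝ) ^ 2 ≤ Real.pi * J ^ 2 :=
      mul_le_mul_of_nonneg_right Real.pi_gt_three.le (sq_nonneg _)
    linarith
  -- The upper bound on the cardinality needs no counting: separated points in the unit disk are at
  -- most O(w⁴) by area.
  · have h := card_mul_sq_le_of_separated hρ zero_le_one hsep' (c := 0) (fun x hx => hball hx)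
    rw [← hN] at h
    have h1 : 20 / w ^ 2 ≤ 1 := by rw [div_le_one hw2]; linarith
    have h2 : (1 + 20 / w ^ 2 / 2) ^ 2 ≤ 4 := by nlinarith
    have h3 : N * (20 / w ^ 2 / 2) ^ 2 = 100 * N / w ^ 4 := by field_simp; ring
    have h4 : 100 * N / w ^ 4 ≤ 4 := by rw [← h3]; exact h.trans h2
    rw [div_le_iff₀ (by positivity)] at h4
    linarith [show 0 < w ^ 4 by positivity]
  · have h := layerNumber_nestedPoints_ge (ρ := 20 / w ^ 2) hρ hk hsin
    have h1 : 3 / w * (999 / 1000 * (w ^ 2 / 20)) ^ 2 ≤ Real.pi / k * J ^ 2 :=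
      mul_le_mul haw hJ2 (by positivity) (by positivity)
    have h2 : 3 / w * (999 / 1000 * (w ^ 2 / 20)) ^ 2 = 3 * (999 / 20000) ^ 2 * w ^ 3 := by
      field_simp; norm_num
    have h3 : 100000 * w ^ 2 ≤ w ^ 3 := by nlinarith
    linarith

theorem theorem1p2 (α : ℝ) (hα : 1 < α) :
    -- upper bound
    (∃ K : ℝ, 0 < K ∧ ∀ X : Finset (EuclideanSpace ℝ (Fin 2)), IsEvenlyDistributed α X →
      (layerNumber X : ℝ) ≤ K * (X.card : ℝ) ^ (3 / 4 : ℝ)) ∧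
    -- sharpness, by points spaced along nested scaled copies of a regular polygon
    (∃ C β a b c : ℝ, 0 < C ∧ 0 < β ∧ 0 < a ∧ 0 < b ∧ 0 < c ∧
      ∀ᶠ n : ℕ in atTop, ∃ X : Finset (EuclideanSpace ℝ (Fin 2)),
        IsEvenlyDistributed α X ∧
        (∀ x ∈ X, ∃ j : ℕ, 1 ≤ j ∧ j ≤ ⌊√(n : ℝ) / C⌋₊ ∧
          x ∈ frontier (regularPolygon ⌊(n : ℝ) ^ (1 / 4 : ℝ)⌋₊ ((j : ℝ) * (C / √(n : ℝ))))) ∧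
        (∀ x ∈ X, ∀ y ∈ X, x ≠ y → β / √(n : ℝ) ≤ dist x y) ∧
        a * (n : ℝ) ≤ (X.card : ℝ) ∧ (X.card : ℝ) ≤ b * (n : ℝ) ∧
        c * (X.card : ℝ) ^ (3 / 4 : ℝ) ≤ (layerNumber X : ℝ)) := by
  refine ⟨exists_layerNumber_le_rpow (by linarith), 20, 20, 1 / 1000, 1, 1 / 1000, by norm_num,
    by norm_num, by norm_num, by norm_num, by norm_num, ?_⟩
  have htend : Tendsto (fun n : ℕ => (n : ℝ) ^ (1 / 4 : ℝ)) atTop atTop :=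
    (tendsto_rpow_atTop (by norm_num)).comp tendsto_natCast_atTop_atTop
  filter_upwards [htend.eventually_ge_atTop 100000] with n hn
  have hn0 : (0 : ℝ) ≤ n := Nat.cast_nonneg n
  set w : ℝ := (n : ℝ) ^ (1 / 4 : ℝ) with hw
  have hw4 : w ^ 4 = n := by
    rw [hw, ← Real.rpow_natCast, ← Real.rpow_mul hn0]; norm_num
  have hw2 : √(n : ℝ) = w ^ 2 := by
    rw [← hw4, show w ^ 4 = (w ^ 2) ^ 2 by ring, Real.sqrt_sq (by positivity)]
  obtain ⟨h1, h2, h3, h4, h5, h6⟩ := nestedPoints_sharp hα hn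
  rw [hw2, ← hw4]
  refine ⟨_, h1, h2, h3, h4, h5, le_trans ?_ h6⟩
  have hw0 : 0 ≤ w := by linarith
  have h7 : (w ^ 4) ^ (3 / 4 : ℝ) = w ^ 3 := by
    rw [← Real.rpow_natCast, ← Real.rpow_mul hw0, ← Real.rpow_natCast]; norm_num
  -- Since b = 1, |X| ≤ w⁴, so a layer bound in terms of w³ is already one in terms of |X|^(3/4).
  rw [← h7]
  gcongr
  linarith
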